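/- Let $n\ge 1$, let $\mathcal L=\mathcal L(\partial_1,\dots,\partial_n)=\sum_\alpha c_\alpha\partial^\alpha\neq 0$ be a polynomial differential operator with constant coefficients $c_\alpha\in\mathbb C$, with formal adjoint $\mathcal L^\dagger=\mathcal L(-\partial_1,\dots,-\partial_n)$ and order $d$. Let $\Omega\subset\mathbb R^n$ be an open set with piecewise smooth boundary: $\partial\Omega$ is a locally finite union of patches, each the image of the closed unit cube $[0,1]^{n-1}$ under a smooth map; on the open cube each patch is injective and an oriented immersion, the points reached from the open cube lie on no other patch and are not images of the boundary of the cube, and there $\Omega$ lies on one side of the patch only. Let $\partial\Omega$ carry the boundary (outward normal first) orientation, and let $\int_{\partial\Omega}$ of an $(n-1)$-form be the sum of the integrals of its pull-backs under the patches. Let $q\in C^d(\Omega)\cap L^1(\Omega)$ be a complex-valued solution of $\mathcal L q=0$ in $\Omega$. For every $k\in\mathbb R^n$ let $\eta(\cdot,k)$ be a fundamental form for $\mathcal L$ built with $\tilde q(y)=e^{-ik\cdot y}$, that is, an $(n-1)$-form, continuous on $\overline\Omega$ and $C^1$ in $\Omega$, such that $$d\eta=\big(\tilde q\,\mathcal L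 q-q\,\mathcal L^\dagger\tilde q\big)\,dx^1\wedge\dots\wedge dx^n\quad\text{in }\Omega,$$ which is absolutely integrable over $\Omega$ and over $\partial\Omega$ (both automatic if $\Omega$ is bounded). Then $$q(x)=\frac{-1}{(2\pi)^n}\int_{\mathbb R^n}dk\int_{\partial\Omega}\frac{e^{ik\cdot x}\,\eta(y,k)}{\mathcal L(ik)},\qquad x\in\Omega,$$ in each of the following senses, where $F(x,k)=\int_{y\in\partial\Omega}e^{ik\cdot x}\eta(y,k)/\mathcal L(ik)$ (defined for almost every $k$): 1. for every $x\in\Omega$, as an oscillatory integral: for every Schwartz function $\chi$ with $\chi(0)=1$, the function $k\mapsto\chi(\varepsilon k)F(x,k)$ is integrable for all $\varepsilon>0$, and $q(x)=\frac{-1}{(2\pi)^n}\lim_{\varepsilon\to0^+}\int_{\mathbb R^n}\chi(\varepsilon k)F(x,k)\,dk$; 2. as distributions on $\Omega$: for every $\varphi\in C_c^\infty(\Omega)$, the function $k\mapsto\int_\Omega\varphi(x)F(x,k)\,dx$ is integrable and $\int_\Omega\varphi(x)\, q(x)\,dx=\frac{-1}{(2\pi)^n}\int_{\mathbb R^n}\Big(\int_\Omega\varphi(x)F(x,k)\,dx\Big)dk$;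 3. for every $x\in\Omega$ such that $F(x,\cdot)$ is integrable, as a Lebesgue integral. -/

import Mathlib

open MeasureTheory Filter Topology
open scoped SchwartzMap ContDiff

noncomputable section

/-- Euclidean space of dimension `n`. -/
abbrev Euc (n : ℕ) : Type := EuclideanSpace ℝ (Fin n)

/-- The `j`-th standard basis vector. -/
def basisVec {n : ℕ} (j : Fin n) : Euc n := EuclideanSpace.single j 1

/-- The partial derivative `∂_j f`. -/
def partialD {n : ℕ} (j : Fin n) (f : Euc n → ℂ) : Euc n → ℂ :=
  fun x => fderiv ℝ f x (basisVec j)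

/-- The mixed partial derivative `∂^α f = ∂_1^{α_1} ⋯ ∂_n^{α_n} f`. -/
def mixedD {n : ℕ} (α : Fin n →₀ ℕ) (f : Euc n → ℂ) : Euc n → ℂ :=
  (List.finRange n).foldr (fun j g => (partialD j)^[α j] g) f

/-- The constant coefficient differential operator `L(∂_1, …, ∂_n) = ∑ c_α ∂^α`. -/
def applyPDO {n : ℕ} (L : MvPolynomial (Fin n) ℂ) (f : Euc n → ℂ) : Euc n → ℂ :=
  fun x => ∑ α ∈ L.support, L.coeff α * mixedD α f x

/-- The formal adjoint `L†(∂) = L(-∂_1, …, -∂_n)`. -/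
def formalAdjoint {n : ℕ} (L : MvPolynomial (Fin n) ℂ) : MvPolynomial (Fin n) ℂ :=
  MvPolynomial.bind₁ (fun j => -MvPolynomial.X j) L

/-- The value `L(i k_1, …, i k_n)`. -/
def symbolAt {n : ℕ} (L : MvPolynomial (Fin n) ℂ) (k : Euc n) : ℂ :=
  MvPolynomial.eval (fun j => Complex.I * (k j : ℂ)) L

/-- The exponential `e^{i k·x}`. -/
def planeWave {n : ℕ} (k x : Euc n) : ℂ :=
  Complex.exp (Complex.I * ((inner ℝ k x : ℝ) : ℂ))

/-- Complex-valued differential `m`-forms on `ℝⁿ`. -/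
abbrev DiffForm (n m : ℕ) : Type := Euc n → (Euc n) [⋀^Fin m]→L[ℝ] ℂ

/-- `η` is a fundamental form on `Ω` for the operator `L` and the pair `q`, `q'`:
an `(n-1)`-form (with `n = m + 1`), continuous up to the boundary and `C¹` inside, with
`dη = (q' L q - q L† q') dx¹ ∧ ⋯ ∧ dxⁿ` in `Ω`. The equality of `n`-forms on `ℝⁿ` is expressed
by evaluation on the standard basis. -/
structure IsFundamentalForm {m : ℕ} (L : MvPolynomial (Fin (m + 1)) ℂ) (Ω : Set (Euc (m + 1)))
    (q q' : Euc (m + 1) → ℂ) (η : DiffForm (m + 1) m) : Prop where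
  continuousOn : ContinuousOn η (closure Ω)
  contDiffOn : ContDiffOn ℝ 1 η Ω
  extDeriv_eq : ∀ x ∈ Ω, extDeriv η x (fun j => basisVec j) =
    q' x * applyPDO L q x - q x * applyPDO (formalAdjoint L) q' x

/-- The closed unit cube in `ℝᵐ` (a point if `m = 0`). -/
def closedCube (m : ℕ) : Set (Fin m → ℝ) := Set.Icc 0 1

/-- The open unit cube in `ℝᵐ` (a point if `m = 0`). -/
def openCube (m : ℕ) : Set (Fin m → ℝ) := Set.univ.pi fun _ => Set.Ioo 0 1

/-- The tangent vectors `∂_1 φ, …, ∂_m φ` of a patch `φ` at the parameter `u`. -/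
def patchTangent {n m : ℕ} (φ : (Fin m → ℝ) → Euc n) (u : Fin m → ℝ) : Fin m → Euc n :=
  fun j => fderiv ℝ φ u (Pi.single j 1)

/-- A piecewise smooth parametrization of the boundary of a set `Ω ⊆ ℝ^{m+1}`, with the boundary
orientation. The boundary is a locally finite union of patches, each of which is a smooth image of
the closed unit cube of dimension `m`. In its open cube a patch is injective, and the points
reached there belong to no other patch. At each such point there is a vector `ν` that points from
`Ω` to the outside, such that `(ν, ∂_1 φ, …, ∂_m φ)` is a basis of `ℝ^{m+1}`, which is positively
oriented if the sign of the patch is `1` and negatively oriented if it is `-1`. -/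
structure PiecewiseSmoothBoundary {m : ℕ} (Ω : Set (Euc (m + 1))) where
  ι : Type
  patch : ι → (Fin m → ℝ) → Euc (m + 1)
  sgn : ι → ℤˣ
  smooth : ∀ i, ContDiffOn ℝ ∞ (patch i) (closedCube m)
  frontier_eq : frontier Ω = ⋃ i, patch i '' closedCube m
  locallyFinite : LocallyFinite fun i => patch i '' closedCube m
  nonoverlapping : ∀ i j, ∀ u ∈ openCube m, ∀ v ∈ closedCube m,
    patch i u = patch j v → i = j ∧ u = v
  outward : ∀ i, ∀ u ∈ openCube m, ∃ ν : Euc (m + 1),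
    0 < ((sgn i : ℤ) : ℝ) * (EuclideanSpace.basisFun (Fin (m + 1)) ℝ).toBasis.det
      (Fin.cons ν (patchTangent (patch i) u)) ∧
    ∀ᶠ t : ℝ in 𝓝[>] 0, patch i u + t • ν ∉ Ω ∧ patch i u - t • ν ∈ Ω

namespace PiecewiseSmoothBoundary

variable {m : ℕ} {Ω : Set (Euc (m + 1))}

/-- The coefficient of the pull-back of the `m`-form `η` to the cube under the `i`-th patch. -/
def pullback (B : PiecewiseSmoothBoundary Ω) (η : DiffForm (m + 1) m) (i : B.ι)
    (u : Fin m → ℝ) : ℂ :=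
  η (B.patch i u) (patchTangent (B.patch i) u)

/-- Absolute integrability of the `m`-form `η` over the boundary. -/
def FormIntegrable (B : PiecewiseSmoothBoundary Ω) (η : DiffForm (m + 1) m) : Prop :=
  (∀ i, IntegrableOn (B.pullback η i) (openCube m)) ∧
    Summable fun i => ∫ u in openCube m, ‖B.pullback η i u‖

/-- The integral `∫_{∂Ω} η` of the `m`-form `η` over the oriented boundary. -/
def formIntegral (B : PiecewiseSmoothBoundary Ω) (η : DiffForm (m + 1) m) : ℂ :=
  ∑' i, ((B.sgn i : ℤ) : ℂ) * ∫ u in openCube m, B.pullback η i u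

end PiecewiseSmoothBoundary

/-- `∫_{ℝⁿ} F(k) dk = J` as an oscillatory integral: for every Schwartz function `χ` with
`χ(0) = 1`, the absolutely convergent integrals `∫ χ(εk) F(k) dk` tend to `J` as `ε → 0⁺`. -/
def HasOscillatoryIntegral {n : ℕ} (F : Euc n → ℂ) (J : ℂ) : Prop :=
  ∀ χ : 𝓢(Euc n, ℂ), χ 0 = 1 →
    (∀ ε : ℝ, 0 < ε → Integrable fun k => χ (ε • k) * F k) ∧
    Tendsto (fun ε : ℝ => ∫ k, χ (ε • k) * F k) (𝓝[>] 0) (𝓝 J)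

/-- The integrand `∫_{y ∈ ∂Ω} e^{i k·x} η(y, k) / L(ik)` of the integral representation. -/
def spectralIntegrand {m : ℕ} {Ω : Set (Euc (m + 1))} (B : PiecewiseSmoothBoundary Ω)
    (L : MvPolynomial (Fin (m + 1)) ℂ) (η : Euc (m + 1) → DiffForm (m + 1) m)
    (x k : Euc (m + 1)) : ℂ :=
  B.formIntegral fun y => (planeWave k x / symbolAt L k) • η k y

end

/-! For the plane wave `e^{-ik·y}` the two minus signs cancel: the formal adjoint acts on it as
multiplication by `L(ik)`. Since `L q = 0`, the fundamental form satisfies `dη = -L(ik) e^{-ik·y} q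
dx` in `Ω`, and Stokes' theorem shows that the boundary integral of `η` is `-L(ik)` times the
Fourier transform of `q` extended by zero. The zeros of `L(ik)` are Lebesgue null, so for almost
every `k` the spectral integrand is `-e^{ik·x}` times that transform, and the claim becomes Fourier
inversion for an `L¹` function that is continuous at each point of `Ω`. The three senses correspond
to three forms of inversion: Schwartz regularisation turns into convolution with an approximate
identity (`tendsto_integral_schwartz_mul_fourier`), testing against `φ` turns into the
multiplication formula (`integral_fourier_mul_fourierInv_schwartz`), and integrability of the
transform permits the classical theorem.

The bulk of the work is `PiecewiseSmoothBoundary.stokes`, for a form that is only continuous up to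
the boundary and on a domain with edges, possibly unbounded. Near an interior point of a patch `φ`,
the collar `(t, u) ↦ φ(u) + tν` straightens `Ω` to a half-cube, and the divergence theorem on a box
needs just continuity on the closed box and differentiability inside with integrable divergence. In
the interior of `Ω` a compactly supported exact form integrates to zero. These local statements are
glued over a compact support that avoids the edges.

The edges have codimension two: `O(N^{m-1})` balls of radius `O(1/N)` cover them locally. Cutting
these balls out costs a gradient of `L¹` norm `O(N^{m-1} · N^{-m}) = O(1/N)`, which is negligible
against a form bounded on compact sets (`SmallCover.exists_cutoff`). Infinity is removed by cutoffs
at scale `R`, whose gradient is `O(1/R)`, against a form integrable on `Ω`. -/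

section Fourier

/-! ### Fourier inversion regularised by Schwartz functions -/

open Module FourierTransform
open scoped RealInnerProductSpace

theorem tendsto_pow_mul_norm_schwartz {V : Type*} [NormedAddCommGroup V] [InnerProductSpace ℝ V]
    (Ψ : 𝓢(V, ℂ)) (a : ℝ) :
    Tendsto (fun y => ‖y‖ ^ finrank ℝ V * (a * ‖Ψ y‖)) (Bornology.cobounded V) (𝓝 0) := by
  obtain ⟨C, hC⟩ := Ψ.decay (finrank ℝ V + 1) 0
  have h1 : Tendsto (fun y : V => ‖y‖⁻¹ * (|a| * C)) (Bornology.cobounded V) (𝓝 0) := by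
    simpa using (tendsto_inv_atTop_zero.comp (tendsto_norm_cobounded_atTop (E := V))).mul_const
      (|a| * C)
  refine squeeze_zero_norm' ?_ h1
  filter_upwards [(tendsto_norm_cobounded_atTop (E := V)).eventually_gt_atTop 0] with y hy
  have h2 := hC.2 y
  rw [norm_iteratedFDeriv_zero, pow_succ] at h2
  rw [inv_mul_eq_div, le_div_iff₀ hy, norm_mul, norm_mul, norm_pow, norm_norm, norm_norm,
    Real.norm_eq_abs]
  calc _ = |a| * (‖y‖ ^ finrank ℝ V * ‖y‖ * ‖Ψ y‖) := by ring
    _ ≤ _ := by gcongr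

variable {V : Type*} [NormedAddCommGroup V] [InnerProductSpace ℝ V] [FiniteDimensional ℝ V]
  [MeasurableSpace V] [BorelSpace V]

theorem integral_pow_mul_comp_smul (f : V → ℂ) {c : ℝ} (hc : 0 < c) :
    ∫ y, (c : ℂ) ^ finrank ℝ V * f (c • y) = ∫ y, f y := by
  rw [integral_const_mul, Measure.integral_comp_smul, abs_of_nonneg (by positivity),
    Complex.real_smul, ← mul_assoc]
  have : (c : ℂ) ≠ 0 := by exact_mod_cast hc.ne'
  push_cast
  rw [mul_inv_cancel₀ (by positivity), one_mul]

/-- Undoing the dilation replaces the unit ball by the ball of radius `c`, which exhausts the space.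
-/
theorem tendsto_integral_ball_comp_smul (Ψ : 𝓢(V, ℂ)) :
    Tendsto (fun c : ℝ => ∫ y, ((c : ℂ) ^ finrank ℝ V * Ψ (c • y)) *
      (Metric.closedBall (0 : V) 1).indicator (fun _ => (1 : ℂ)) y) atTop (𝓝 (∫ y, Ψ y)) := by
  have h : Tendsto (fun c : ℝ => ∫ y, (Metric.closedBall (0 : V) c).indicator Ψ y) atTop
      (𝓝 (∫ y, Ψ y)) := by
    refine tendsto_integral_filter_of_dominated_convergence (fun y => ‖Ψ y‖) ?_ ?_ Ψ.integrable.norm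
      ?_
    · exact Eventually.of_forall fun c =>
        Ψ.integrable.aestronglyMeasurable.indicator Metric.isClosed_closedBall.measurableSet
    · exact Eventually.of_forall fun c => Eventually.of_forall fun y =>
        norm_indicator_le_norm_self _ _
    · refine Eventually.of_forall fun y => tendsto_const_nhds.congr' ?_
      filter_upwards [eventually_ge_atTop ‖y‖] with c hc
      rw [Set.indicator_of_mem (by simpa using hc)]
  refine h.congr' ?_
  filter_upwards [eventually_gt_atTop 0] with c hc
  rw [← integral_pow_mul_comp_smul _ hc]
  congr 1 with y
  by_cases hy : ‖y‖ ≤ 1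
  · rw [Set.indicator_of_mem, Set.indicator_of_mem (by simpa using hy), mul_one]
    simpa [norm_smul, abs_of_pos hc] using mul_le_of_le_one_right hc.le hy
  · rw [Set.indicator_of_notMem, Set.indicator_of_notMem (by simpa using hy), mul_zero, mul_zero]
    simpa [norm_smul, abs_of_pos hc] using (lt_mul_iff_one_lt_right hc).2 (not_le.1 hy)

/-- Approximate identities are available for nonnegative kernels of mass one. The complex kernel is
therefore dominated by `N` times the normalised kernel `‖Ψ‖ / N`, which suffices because the limit
value `h 0` is zero. -/
theorem tendsto_integral_norm_schwartz_mul (Ψ : 𝓢(V, ℂ)) {h : V → ℂ} (hh : Integrable h)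
    (hc : ContinuousAt h 0) (h0 : h 0 = 0) :
    Tendsto (fun c : ℝ => ∫ y, ((c : ℂ) ^ finrank ℝ V * Ψ (c • y)) * h y) atTop (𝓝 0) := by
  -- A kernel of zero mass cannot be normalised, but then it vanishes identically.
  rcases eq_or_ne (∫ y, ‖Ψ y‖) 0 with hN | hN
  · have : ∀ y, Ψ y = 0 := by
      rw [integral_eq_zero_iff_of_nonneg (fun _ => norm_nonneg _) Ψ.integrable.norm] at hN
      have := (Ψ.continuous.norm.ae_eq_iff_eq _ continuous_const).1 hN
      exact fun y => norm_eq_zero.1 (congrFun this y)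
    simp [this]
  set N := ∫ y, ‖Ψ y‖
  have hN0 : 0 < N := lt_of_le_of_ne (integral_nonneg fun _ => norm_nonneg _) hN.symm
  have key := tendsto_integral_comp_smul_smul_of_integrable (μ := (volume : Measure V))
    (φ := fun y => N⁻¹ * ‖Ψ y‖) (fun y => by positivity)
    (by rw [integral_const_mul]; exact inv_mul_cancel₀ hN) (tendsto_pow_mul_norm_schwartz Ψ N⁻¹)
    hh.norm hc.norm
  rw [h0, norm_zero] at key
  have key2 := key.const_mul N
  rw [mul_zero] at key2
  refine squeeze_zero_norm' ?_ key2
  filter_upwards [eventually_gt_atTop 0] with c hc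
  refine (norm_integral_le_integral_norm _).trans_eq ?_
  rw [← integral_const_mul]
  congr 1 with y
  simp only [norm_mul, norm_pow, Complex.norm_real, Real.norm_eq_abs, abs_of_pos hc, smul_eq_mul]
  field_simp

/-- Split `g` as `g 0 • b` plus a remainder vanishing at `0`, where `b` is the indicator of the unit
ball. The constant `g 0` itself is not integrable, hence the truncation. -/
theorem tendsto_integral_schwartz_comp_smul_mul (Ψ : 𝓢(V, ℂ)) {g : V → ℂ} (hg : Integrable g)
    (hc : ContinuousAt g 0) :
    Tendsto (fun c : ℝ => ∫ y, ((c : ℂ) ^ finrank ℝ V * Ψ (c • y)) * g y) atTop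
      (𝓝 ((∫ y, Ψ y) * g 0)) := by
  set b : V → ℂ := (Metric.closedBall (0 : V) 1).indicator (fun _ => (1 : ℂ)) with hb
  have hbi : Integrable b := (integrable_indicator_iff Metric.isClosed_closedBall.measurableSet).2
    (integrableOn_const (isCompact_closedBall _ _).measure_ne_top)
  have hb0 : b =ᶠ[𝓝 0] fun _ => 1 := by
    filter_upwards [Metric.closedBall_mem_nhds (0 : V) one_pos] with y hy
    rw [hb, Set.indicator_of_mem hy]
  have hbc : ContinuousAt b 0 := continuousAt_const.congr hb0.symm
  have h1 := tendsto_integral_norm_schwartz_mul Ψ (hg.sub (hbi.const_mul (g 0)))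
    (hc.sub (hbc.const_smul (g 0))) (by simp [hb0.self_of_nhds])
  have h2 := (tendsto_integral_ball_comp_smul Ψ).mul_const (g 0)
  have h3 := h1.add h2
  rw [zero_add] at h3
  refine h3.congr fun c => ?_
  have hbd : ∃ C, ∀ y, ‖(c : ℂ) ^ finrank ℝ V * Ψ (c • y)‖ ≤ C := by
    obtain ⟨C, hC⟩ := Ψ.decay 0 0
    refine ⟨‖(c : ℂ) ^ finrank ℝ V‖ * C, fun y => ?_⟩
    rw [norm_mul]
    gcongr
    simpa using hC.2 (c • y)
  have hm : AEStronglyMeasurable (fun y => (c : ℂ) ^ finrank ℝ V * Ψ (c • y)) volume :=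
    (continuous_const.mul (Ψ.continuous.comp (continuous_const_smul c))).aestronglyMeasurable
  obtain ⟨C, hC⟩ := hbd
  have hi : ∀ {f : V → ℂ}, Integrable f →
      Integrable fun y => ((c : ℂ) ^ finrank ℝ V * Ψ (c • y)) * f y := fun hf =>
    hf.bdd_mul hm (Eventually.of_forall hC)
  rw [← integral_mul_const, ← integral_add (hi (hg.sub (hbi.const_mul _))) ((hi hbi).mul_const _)]
  congr 1 with y
  simp only [Pi.sub_apply]
  ring

theorem integral_fourier_mul_eq {f g : V → ℂ} (hf : Integrable f) (hg : Integrable g) :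
    ∫ w, 𝓕 f w * g w = ∫ y, f y * 𝓕 g y := by
  have := VectorFourier.integral_fourierIntegral_smul_eq_flip (L := innerₗ V)
    Real.continuous_fourierChar continuous_inner hf hg
  simpa [Real.fourier_eq, VectorFourier.fourierIntegral, real_inner_comm] using this

theorem norm_fourier_le_integral_norm (f : V → ℂ) (w : V) : ‖𝓕 f w‖ ≤ ∫ y, ‖f y‖ :=
  VectorFourier.norm_fourierIntegral_le_integral_norm _ _ _ _ _

/-- A dilated and modulated regulator transforms into a concentrated kernel centred at `x`: this is
the approximate identity behind the oscillatory integral. -/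
theorem fourier_comp_smul_mul_fourierChar (χ : 𝓢(V, ℂ)) {s : ℝ} (hs : 0 < s) (x y : V) :
    𝓕 (fun w => χ (s • w) * (Real.fourierChar ⟪w, x⟫ : ℂ)) y =
      ((s⁻¹ : ℝ) : ℂ) ^ finrank ℝ V * (𝓕 χ) (s⁻¹ • (y - x)) := by
  rw [SchwartzMap.fourier_coe, Real.fourier_eq, Real.fourier_eq,
    ← integral_pow_mul_comp_smul (fun v => Real.fourierChar (-⟪v, s⁻¹ • (y - x)⟫) • χ v) hs,
    ← integral_const_mul]
  congr 1 with w
  have hs' : (s : ℂ) ≠ 0 := by exact_mod_cast hs.ne'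
  have hp : (Real.fourierChar (-⟪s • w, s⁻¹ • (y - x)⟫) : ℂ) =
      (Real.fourierChar (-⟪w, y⟫) : ℂ) * (Real.fourierChar ⟪w, x⟫ : ℂ) := by
    rw [← Circle.coe_mul, ← AddChar.map_add_eq_mul]
    congr 3
    rw [real_inner_smul_left, real_inner_smul_right, inner_sub_right, mul_inv_cancel_left₀ hs.ne']
    ring
  simp only [Circle.smul_def, smul_eq_mul, hp]
  rw [Complex.ofReal_inv, inv_pow, inv_mul_cancel_left₀ (pow_ne_zero _ hs')]
  ring

/-- The multiplication formula moves the transform from `f` to the regulator, leaving an approximate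
identity at `x`. Its total mass is `∫ 𝓕 χ = χ 0`, by inversion for `χ` at the origin. -/
theorem tendsto_integral_schwartz_mul_fourier (χ : 𝓢(V, ℂ)) {f : V → ℂ} (hf : Integrable f) {x : V}
    (hx : ContinuousAt f x) :
    Tendsto (fun s : ℝ => ∫ w, χ (s • w) * ((Real.fourierChar ⟪w, x⟫ : ℂ) * 𝓕 f w)) (𝓝[>] 0)
      (𝓝 (χ 0 * f x)) := by
  have h1 := (tendsto_integral_schwartz_comp_smul_mul (𝓕 χ) (g := fun y => f (y + x))
    (hf.comp_add_right x) (by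
      refine ContinuousAt.comp (g := f) (by simpa using hx) (by fun_prop))).comp
        tendsto_inv_nhdsGT_zero
  have h2 : ∫ y, (𝓕 χ) y = χ 0 := by
    have : 𝓕⁻ (𝓕 χ) = χ := FourierTransform.fourierInv_fourier_eq χ
    conv_rhs => rw [← this]
    rw [SchwartzMap.fourierInv_coe, Real.fourierInv_eq]
    simp
  rw [h2, zero_add] at h1
  refine h1.congr' ?_
  filter_upwards [self_mem_nhdsWithin] with s (hs : 0 < s)
  have hi : Integrable fun w => χ (s • w) * (Real.fourierChar ⟪w, x⟫ : ℂ) := by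
    refine (χ.integrable.comp_smul hs.ne').mul_bdd (c := 1) ?_ ?_
    · have : Continuous fun w : V => (Real.fourierChar ⟪w, x⟫ : ℂ) :=
        continuous_subtype_val.comp (Real.continuous_fourierChar.comp (by fun_prop))
      exact this.aestronglyMeasurable
    · exact Eventually.of_forall fun w => (Circle.norm_coe _).le
  have h3 := integral_fourier_mul_eq hi hf
  simp only [mul_assoc] at h3
  rw [← h3]
  simp only [fourier_comp_smul_mul_fourierChar χ hs]
  simp only [Function.comp_apply]
  rw [← integral_sub_right_eq_self (μ := volume) _ x]
  simp only [sub_add_cancel]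

theorem integral_fourier_mul_fourierInv_schwartz (φ : 𝓢(V, ℂ)) {f : V → ℂ} (hf : Integrable f) :
    ∫ w, 𝓕 f w * (𝓕⁻ φ) w = ∫ y, f y * φ y := by
  rw [integral_fourier_mul_eq hf (𝓕⁻ φ).integrable, ← SchwartzMap.fourier_coe]
  rw [FourierTransform.fourier_fourierInv_eq φ]

end Fourier

/-! ### The symbol: action on plane waves and null zero set -/

section Symbol

theorem partialD_const_mul_planeWave {n : ℕ} (j : Fin n) (c : ℂ) (k : Euc n) :
    partialD j (fun x => c * planeWave k x) =
      fun x => (Complex.I * (k j : ℂ) * c) * planeWave k x := by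
  funext x
  have h1 : HasFDerivAt (fun x : Euc n => Complex.I * ((inner ℝ k x : ℝ) : ℂ))
      (Complex.I • (Complex.ofRealCLM.comp (innerSL ℝ k))) x :=
    ((Complex.ofRealCLM.comp (innerSL ℝ k)).hasFDerivAt).const_mul Complex.I
  have h2 := (h1.cexp).const_mul c
  unfold partialD
  have h3 : fderiv ℝ (fun x => c * planeWave k x) x = _ := h2.fderiv
  rw [h3]
  simp only [planeWave, smul_apply, ContinuousLinearMap.comp_apply,
    innerSL_apply_apply, basisVec, EuclideanSpace.inner_single_right, smul_eq_mul,
    Complex.ofRealCLM_apply, one_mul, conj_trivial]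
  ring

theorem iterate_partialD_const_mul_planeWave {n : ℕ} (j : Fin n) (a : ℕ) (c : ℂ) (k : Euc n) :
    (partialD j)^[a] (fun x => c * planeWave k x) =
      fun x => ((Complex.I * (k j : ℂ)) ^ a * c) * planeWave k x := by
  induction a with
  | zero => simp
  | succ a ih =>
    rw [Function.iterate_succ_apply', ih, partialD_const_mul_planeWave]
    funext x
    ring

theorem mixedD_planeWave {n : ℕ} (α : Fin n →₀ ℕ) (k : Euc n) :
    mixedD α (planeWave k) =
      fun x => (∏ j, (Complex.I * (k j : ℂ)) ^ α j) * planeWave k x := by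
  have h : ∀ l : List (Fin n), l.foldr (fun j g => (partialD j)^[α j] g) (planeWave k) =
      fun x => (l.map fun j => (Complex.I * (k j : ℂ)) ^ α j).prod * planeWave k x := by
    intro l
    induction l with
    | nil => simp
    | cons j l ih =>
      rw [List.foldr_cons, ih, iterate_partialD_const_mul_planeWave, List.map_cons, List.prod_cons]
  rw [mixedD, h, ← List.ofFn_eq_map, List.prod_ofFn]

theorem applyPDO_planeWave {n : ℕ} (L : MvPolynomial (Fin n) ℂ) (k x : Euc n) :
    applyPDO L (planeWave k) x = symbolAt L k * planeWave k x := by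
  simp only [applyPDO, mixedD_planeWave, symbolAt, MvPolynomial.eval_eq', Finset.sum_mul, mul_assoc]

theorem symbolAt_formalAdjoint_neg {n : ℕ} (L : MvPolynomial (Fin n) ℂ) (k : Euc n) :
    symbolAt (formalAdjoint L) (-k) = symbolAt L k := by
  unfold symbolAt formalAdjoint
  rw [← MvPolynomial.coe_aeval_eq_eval, ← MvPolynomial.coe_aeval_eq_eval]
  simp only [RingHom.coe_coe, MvPolynomial.aeval_bind₁]
  simp

theorem continuous_eval_I_mul {n : ℕ} (p : MvPolynomial (Fin n) ℂ) :
    Continuous fun x : Fin n → ℝ => MvPolynomial.eval (fun j => Complex.I * (x j : ℂ)) p :=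
  (MvPolynomial.continuous_eval p).comp (by fun_prop)

/-- Induction on the number of variables with Fubini. For almost all values of the other variables
the leading coefficient in the first variable is nonzero, and a nonzero polynomial in one variable
has finitely many roots. -/
theorem ae_eval_I_mul_ne_zero {n : ℕ} (p : MvPolynomial (Fin n) ℂ) (hp : p ≠ 0) :
    ∀ᵐ x : Fin n → ℝ, MvPolynomial.eval (fun j => Complex.I * (x j : ℂ)) p ≠ 0 := by
  induction n with
  | zero =>
    refine Eventually.of_forall fun x h => hp ?_
    rw [MvPolynomial.eq_C_of_isEmpty p] at h ⊢
    rw [MvPolynomial.eval_C] at h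
    rw [h, map_zero]
  | succ n ih =>
    set P := MvPolynomial.finSuccEquiv ℂ n p
    have hP : P ≠ 0 := by simpa [P] using hp
    have hlead := ih P.leadingCoeff (Polynomial.leadingCoeff_ne_zero.2 hP)
    set e := MeasurableEquiv.piFinSuccAbove (fun _ : Fin (n + 1) => ℝ) 0
    have he : MeasurePreserving e.symm _ volume := volume_preserving_piFinSuccAbove (fun _ => ℝ) 0 |>.symm e
    set Z : Set (Fin (n + 1) → ℝ) :=
      {x | MvPolynomial.eval (fun j => Complex.I * (x j : ℂ)) p = 0}
    have hZ : MeasurableSet Z :=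
      (isClosed_singleton.preimage (continuous_eval_I_mul p)).measurableSet
    rw [ae_iff]
    simp only [ne_eq, not_not]
    change volume Z = 0
    rw [← he.measure_preimage hZ.nullMeasurableSet, Measure.volume_eq_prod,
      Measure.prod_apply_symm (e.symm.measurable hZ), lintegral_eq_zero_iff
        (measurable_measure_prodMk_right (e.symm.measurable hZ))]
    filter_upwards [hlead] with y hy
    set Q := P.map (MvPolynomial.eval fun j => Complex.I * (y j : ℂ))
    -- The coefficient of `Q` in degree `P.natDegree` is the value at `y` of the leading coefficient
    -- of `P`.
    have hQ : Q ≠ 0 := fun h => hy <| by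
      have := congrArg (fun q => Polynomial.coeff q P.natDegree) h
      simpa [Q, Polynomial.coeff_map] using this
    refine Set.Finite.measure_zero ?_ (volume : Measure ℝ)
    refine ((Q.roots.toFinset.finite_toSet).preimage (f := fun t : ℝ => Complex.I * (t : ℂ))
      ?_).subset ?_
    · intro a _ b _ hab
      simpa using hab
    · intro t ht
      have h1 : MvPolynomial.eval (fun j => Complex.I * ((e.symm (t, y)) j : ℂ)) p = 0 := ht
      have h2 : (fun j => Complex.I * ((e.symm (t, y)) j : ℂ)) =
          Fin.cons (Complex.I * (t : ℂ)) fun j => Complex.I * (y j : ℂ) := by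
        funext j
        refine Fin.cases ?_ (fun i => ?_) j
        · simp [e, MeasurableEquiv.piFinSuccAbove]
        · simp [e, MeasurableEquiv.piFinSuccAbove]
      rw [h2, MvPolynomial.eval_eq_eval_mv_eval'] at h1
      simpa [hQ] using h1

theorem ae_symbolAt_ne_zero {n : ℕ} (L : MvPolynomial (Fin n) ℂ) (hL : L ≠ 0) :
    ∀ᵐ k : Euc n, symbolAt L k ≠ 0 :=
  (EuclideanSpace.volume_preserving_symm_measurableEquiv_toLp (Fin n)).quasiMeasurePreserving.ae
    (ae_eval_I_mul_ne_zero L hL)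

end Symbol

/-- The standard frame of `ℝⁿ`. -/
noncomputable def stdFrame (n : ℕ) : Fin n → Euc n := fun j => basisVec j

theorem norm_basisVec {n : ℕ} (j : Fin n) : ‖(basisVec j : Euc n)‖ = 1 := by
  simp [basisVec]

/-! ### Pointwise algebra of differential forms -/

section Algebra

variable {m : ℕ}

theorem extDeriv_smul_apply {E : Type*} [NormedAddCommGroup E] [NormedSpace ℝ E]
    {χ : E → ℝ} {η : E → E [⋀^Fin m]→L[ℝ] ℂ} {x : E}
    (hχ : DifferentiableAt ℝ χ x) (hη : DifferentiableAt ℝ η x) (v : Fin (m + 1) → E) :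
    extDeriv (fun y => χ y • η y) x v =
      (∑ i : Fin (m + 1), (-1) ^ (i : ℕ) * ((fderiv ℝ χ x (v i) : ℝ) : ℂ) * η x (i.removeNth v)) +
        χ x * extDeriv η x v := by
  rw [extDeriv_apply (hχ.fun_smul hη), extDeriv_apply hη, Finset.mul_sum, ← Finset.sum_add_distrib]
  refine Finset.sum_congr rfl fun i _ => ?_
  have h1 : DifferentiableAt ℝ (fun y => η y (i.removeNth v)) x :=
    hη.continuousAlternatingMap_apply_const _
  have h2 : fderiv ℝ (fun y => χ y • η y (i.removeNth v)) x = _ := fderiv_fun_smul hχ h1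
  simp only [ContinuousAlternatingMap.smul_apply, h2]
  simp only [add_apply, smul_apply, ContinuousLinearMap.smulRight_apply, Complex.real_smul,
    zsmul_eq_mul, Int.reduceNeg, Int.cast_pow, Int.cast_neg, Int.cast_one]
  ring

theorem norm_alternating_apply_le {n k : ℕ} (f : (Euc n) [⋀^Fin k]→L[ℝ] ℂ) (v : Fin k → Euc n)
    (hv : ∀ i, ‖v i‖ = 1) : ‖f v‖ ≤ ‖f‖ := by
  simpa [hv] using f.le_opNorm v

/-- Top-degree alternating forms are multiples of the determinant. That fact is applied to
real-valued forms, so real and imaginary parts are taken separately. -/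
theorem alternating_apply_eq_det_mul {n : ℕ} (f : (Euc n) [⋀^Fin n]→L[ℝ] ℂ) (v : Fin n → Euc n) :
    f v = ((EuclideanSpace.basisFun (Fin n) ℝ).toBasis.det v : ℂ) * f (stdFrame n) := by
  set b := (EuclideanSpace.basisFun (Fin n) ℝ).toBasis
  have hb : (b : Fin n → Euc n) = stdFrame n := by
    funext j
    simp [b, stdFrame, basisVec]
  have h1 := congrArg (fun g => g v)
    ((Complex.reLm.compAlternatingMap f.toAlternatingMap).eq_smul_basis_det b)
  have h2 := congrArg (fun g => g v)
    ((Complex.imLm.compAlternatingMap f.toAlternatingMap).eq_smul_basis_det b)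
  simp only [AlternatingMap.smul_apply, LinearMap.compAlternatingMap_apply, hb, smul_eq_mul] at h1 h2
  apply Complex.ext
  · rw [Complex.re_ofReal_mul, mul_comm]
    exact h1
  · rw [Complex.im_ofReal_mul, mul_comm]
    exact h2

end Algebra

/-! ### Stokes' theorem on a box -/

section Box

variable {m : ℕ}

/-- The exterior derivative is the divergence of the field with components `(-1)^i η(…, ê_i, …)`.
Only the face `x 0 = b 0` survives; its sign is `(-1)^0 = 1`, matching the outward-normal-first
convention. -/
theorem integral_extDeriv_box {a b : Fin (m + 1) → ℝ} (hab : a ≤ b)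
    (η : (Fin (m + 1) → ℝ) → (Fin (m + 1) → ℝ) [⋀^Fin m]→L[ℝ] ℂ)
    (hc : ContinuousOn η (Set.Icc a b))
    (hd : ∀ x ∈ Set.univ.pi fun i => Set.Ioo (a i) (b i), DifferentiableAt ℝ η x)
    (hi : IntegrableOn (fun x => extDeriv η x fun j => Pi.single j 1)
      (Set.univ.pi fun i => Set.Ioo (a i) (b i)))
    (h0 : ∀ x ∈ Set.Icc a b, (x 0 = a 0 ∨ ∃ j ≠ 0, x j = a j ∨ x j = b j) → η x = 0) :
    ∫ x in Set.univ.pi fun i => Set.Ioo (a i) (b i), extDeriv η x (fun j => Pi.single j 1) =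
      ∫ u in Set.Icc (Fin.tail a) (Fin.tail b),
        η (Fin.cons (b 0) u) (fun j => Pi.single j.succ 1) := by
  set f : Fin (m + 1) → (Fin (m + 1) → ℝ) → ℂ := fun i x =>
    (-1) ^ (i : ℕ) * η x (i.removeNth (α := fun _ => Fin (m + 1) → ℝ) fun j => Pi.single j 1) with hf
  have hfd : ∀ x ∈ Set.univ.pi fun i => Set.Ioo (a i) (b i), ∀ i, HasFDerivAt (f i)
      (fderiv ℝ (f i) x) x := fun x hx i =>
    (((hd x hx).continuousAlternatingMap_apply_const _).const_mul _).hasFDerivAt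
  have hdiv : ∀ x ∈ Set.univ.pi fun i => Set.Ioo (a i) (b i),
      extDeriv η x (fun j => Pi.single j 1) = ∑ i, fderiv ℝ (f i) x (Pi.single i 1) := by
    intro x hx
    rw [extDeriv_apply (hd x hx)]
    refine Finset.sum_congr rfl fun i _ => ?_
    have h1 : DifferentiableAt ℝ (fun y => η y (i.removeNth (α := fun _ => Fin (m + 1) → ℝ) fun j => Pi.single j 1)) x :=
      (hd x hx).continuousAlternatingMap_apply_const _
    have h2 : fderiv ℝ (f i) x = _ := fderiv_const_mul h1 _
    rw [h2]
    simp
  have hm : MeasurableSet (Set.univ.pi fun i => Set.Ioo (a i) (b i)) :=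
    MeasurableSet.univ_pi fun i => measurableSet_Ioo
  have hae : (Set.univ.pi fun i => Set.Ioo (a i) (b i)) =ᵐ[volume] Set.Icc a b :=
    Measure.univ_pi_Ioo_ae_eq_Icc
  rw [setIntegral_congr_fun hm hdiv, setIntegral_congr_set hae,
    integral_divergence_of_hasFDerivAt_off_countable' a b hab f (fun i x => fderiv ℝ (f i) x) ∅
      Set.countable_empty]
  · have hz : ∀ (i : Fin (m + 1)) (t : ℝ), (∀ u ∈ Set.Icc (a ∘ i.succAbove) (b ∘ i.succAbove),
        η (i.insertNth t u) = 0) →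
        ∫ u in Set.Icc (a ∘ i.succAbove) (b ∘ i.succAbove), f i (i.insertNth t u) = 0 := by
      intro i t ht
      rw [setIntegral_congr_fun (g := fun _ => 0) measurableSet_Icc, integral_zero]
      intro u hu
      simp [hf, ht u hu]
    have hmem : ∀ (i : Fin (m + 1)) (t : ℝ), t ∈ Set.Icc (a i) (b i) →
        ∀ u ∈ Set.Icc (a ∘ i.succAbove) (b ∘ i.succAbove), i.insertNth t u ∈ Set.Icc a b := by
      intro i t ht u hu
      rw [Fin.insertNth_mem_Icc]
      exact ⟨ht, hu⟩
    rw [Fin.sum_univ_succ, Finset.sum_eq_zero, add_zero, hz 0 (a 0), sub_zero]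
    · have hs : (0 : Fin (m + 1)).succAbove = Fin.succ := by
        funext j; simp
      rw [hs]
      refine setIntegral_congr_fun measurableSet_Icc fun u _ => ?_
      simp only [hf, Fin.insertNth_zero', Fin.val_zero, pow_zero, one_mul]
      rfl
    · intro u hu
      exact h0 _ (hmem 0 _ ⟨le_rfl, hab 0⟩ u hu) (Or.inl (by simp))
    · intro j _
      rw [hz j.succ, hz j.succ, sub_zero]
      · intro u hu
        exact h0 _ (hmem _ _ ⟨le_rfl, hab _⟩ u hu)
          (Or.inr ⟨j.succ, Fin.succ_ne_zero j, Or.inl (by simp)⟩)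
      · intro u hu
        exact h0 _ (hmem _ _ ⟨hab _, le_rfl⟩ u hu)
          (Or.inr ⟨j.succ, Fin.succ_ne_zero j, Or.inr (by simp)⟩)
  · intro i
    exact continuousOn_const.mul (((ContinuousAlternatingMap.apply ℝ _ ℂ _).continuous).comp_continuousOn hc)
  · rintro x ⟨hx, -⟩ i
    exact hfd x hx i
  · exact ((integrableOn_congr_fun hdiv hm).1 hi).congr_set_ae hae.symm

end Box

/-! ### Change of variables from coordinates to Euclidean space -/

section ChangeOfVariables

variable {n : ℕ}

/-- The determinant of a linear map `ℝⁿ → ℝⁿ` from the space of coordinates. -/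
noncomputable def frameDet (D : (Fin n → ℝ) →L[ℝ] Euc n) : ℝ :=
  (EuclideanSpace.basisFun (Fin n) ℝ).toBasis.det fun j => D (Pi.single j 1)

theorem frameDet_eq_det (D : (Fin n → ℝ) →L[ℝ] Euc n) :
    frameDet D = (((EuclideanSpace.equiv (Fin n) ℝ : Euc n →L[ℝ] (Fin n → ℝ))).comp D).det := by
  rw [ContinuousLinearMap.det, ← LinearMap.det_toMatrix', frameDet, Module.Basis.det_apply]
  congr 1

variable {Φ : (Fin n → ℝ) → Euc n} {s : Set (Fin n → ℝ)}

theorem hasFDerivWithinAt_equiv_comp {D : (Fin n → ℝ) → (Fin n → ℝ) →L[ℝ] Euc n}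
    (hD : ∀ z ∈ s, HasFDerivAt Φ (D z) z) (z) (hz : z ∈ s) :
    HasFDerivWithinAt (fun z => EuclideanSpace.equiv (Fin n) ℝ (Φ z))
      (((EuclideanSpace.equiv (Fin n) ℝ : Euc n →L[ℝ] (Fin n → ℝ))).comp (D z)) s z :=
  ((EuclideanSpace.equiv (Fin n) ℝ).hasFDerivAt.comp z (hD z hz)).hasFDerivWithinAt

theorem preimage_image_equiv_comp :
    ⇑(EuclideanSpace.equiv (Fin n) ℝ) ⁻¹' ((fun z => EuclideanSpace.equiv (Fin n) ℝ (Φ z)) '' s) =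
      Φ '' s := by
  have : (fun z => EuclideanSpace.equiv (Fin n) ℝ (Φ z)) = (EuclideanSpace.equiv (Fin n) ℝ) ∘ Φ := rfl
  rw [this, Set.image_comp, Set.preimage_image_eq _ (EuclideanSpace.equiv (Fin n) ℝ).injective]

theorem integral_image_eq_integral_frameDet (hs : MeasurableSet s)
    {D : (Fin n → ℝ) → (Fin n → ℝ) →L[ℝ] Euc n}
    (hD : ∀ z ∈ s, HasFDerivAt Φ (D z) z) (hΦ : Set.InjOn Φ s) (g : Euc n → ℂ) :
    ∫ y in Φ '' s, g y = ∫ z in s, |frameDet (D z)| • g (Φ z) := by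
  have h := integral_image_eq_integral_abs_det_fderiv_smul volume hs
    (hasFDerivWithinAt_equiv_comp hD)
    ((EuclideanSpace.equiv (Fin n) ℝ).injective.comp_injOn hΦ)
    (fun x => g ((EuclideanSpace.equiv (Fin n) ℝ).symm x))
  simp only [ContinuousLinearEquiv.symm_apply_apply] at h
  simp only [frameDet_eq_det]
  rw [← h, ← preimage_image_equiv_comp,
    ← (EuclideanSpace.volume_preserving_symm_measurableEquiv_toLp (Fin n)).setIntegral_preimage_emb
      (MeasurableEquiv.measurableEmbedding _)]
  rfl

theorem integrableOn_image_iff_integrableOn_frameDet (hs : MeasurableSet s)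
    {D : (Fin n → ℝ) → (Fin n → ℝ) →L[ℝ] Euc n}
    (hD : ∀ z ∈ s, HasFDerivAt Φ (D z) z) (hΦ : Set.InjOn Φ s) (g : Euc n → ℂ) :
    IntegrableOn g (Φ '' s) ↔ IntegrableOn (fun z => |frameDet (D z)| • g (Φ z)) s := by
  have h := integrableOn_image_iff_integrableOn_abs_det_fderiv_smul volume hs
    (hasFDerivWithinAt_equiv_comp hD)
    ((EuclideanSpace.equiv (Fin n) ℝ).injective.comp_injOn hΦ)
    (fun x => g ((EuclideanSpace.equiv (Fin n) ℝ).symm x))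
  simp only [ContinuousLinearEquiv.symm_apply_apply] at h
  simp only [frameDet_eq_det]
  rw [← h, ← preimage_image_equiv_comp,
    ← (EuclideanSpace.volume_preserving_symm_measurableEquiv_toLp (Fin n)).integrableOn_comp_preimage
      (MeasurableEquiv.measurableEmbedding _)]
  rfl

end ChangeOfVariables

/-! ### Stokes' theorem transported by a chart -/

section Chart

variable {m : ℕ}

theorem continuous_compContinuousLinearMap {E F : Type*} [NormedAddCommGroup E] [NormedSpace ℝ E]
    [NormedAddCommGroup F] [NormedSpace ℝ F] :
    Continuous fun p : (F [⋀^Fin m]→L[ℝ] ℂ) × (E →L[ℝ] F) => p.1.compContinuousLinearMap p.2 :=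
  continuous_iff_continuousAt.2 fun p =>
    (ContinuousAlternatingMap.hasStrictFDerivAt_compContinuousLinearMap p).hasFDerivAt.continuousAt

/-- Pull back to the box. The pull-back of a top form carries the signed Jacobian, while the change
of variables carries its absolute value; `σ` is the constant sign between them. Naturality of `d` is
used only in the open box, so `ζ` need not be differentiable at the boundary. -/
theorem integral_extDeriv_eq_of_chart {Ω : Set (Euc (m + 1))} (hΩ : IsOpen Ω)
    {Φ : (Fin (m + 1) → ℝ) → Euc (m + 1)} {a b : Fin (m + 1) → ℝ} (hab : ∀ i, a i < b i)
    (hΦ : ∀ z ∈ Set.Icc a b, ContDiffAt ℝ 2 Φ z)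
    (hinj : Set.InjOn Φ (Set.univ.pi fun i => Set.Ioo (a i) (b i))) (σ : ℤˣ)
    (hdet : ∀ z ∈ Set.univ.pi fun i => Set.Ioo (a i) (b i),
      0 < ((σ : ℤ) : ℝ) * frameDet (fderiv ℝ Φ z))
    (hmaps : Set.MapsTo Φ (Set.univ.pi fun i => Set.Ioo (a i) (b i)) Ω)
    {ζ : DiffForm (m + 1) m} (hc : ContinuousOn ζ (closure Ω))
    (hd : ∀ x ∈ Ω, DifferentiableAt ℝ ζ x)
    (hi : IntegrableOn (fun x => extDeriv ζ x (stdFrame (m + 1))) Ω)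
    (h0 : ∀ z ∈ Set.Icc a b, (z 0 = a 0 ∨ ∃ j ≠ 0, z j = a j ∨ z j = b j) → ζ (Φ z) = 0)
    (hsupp : ∀ x ∈ Ω, x ∉ Φ '' (Set.univ.pi fun i => Set.Ioo (a i) (b i)) →
      extDeriv ζ x (stdFrame (m + 1)) = 0) :
    ∫ x in Ω, extDeriv ζ x (stdFrame (m + 1)) =
      ((σ : ℤ) : ℂ) * ∫ u in Set.Icc (Fin.tail a) (Fin.tail b), ζ (Φ (Fin.cons (b 0) u))
        (fun j => fderiv ℝ Φ (Fin.cons (b 0) u) (Pi.single j.succ 1)) := by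
  set H := Set.univ.pi fun i => Set.Ioo (a i) (b i) with hH
  have hHm : MeasurableSet H := MeasurableSet.univ_pi fun i => measurableSet_Ioo
  have hHcl : closure H = Set.Icc a b := by
    rw [hH, closure_pi_set, ← Set.pi_univ_Icc]
    congr 1
    funext i
    exact closure_Ioo (hab i).ne
  have hHs : H ⊆ Set.Icc a b := hHcl ▸ subset_closure
  have hΦd : ∀ z ∈ H, HasFDerivAt Φ (fderiv ℝ Φ z) z := fun z hz =>
    ((hΦ z (hHs hz)).differentiableAt (by norm_num)).hasFDerivAt
  have hΦc : ContinuousOn Φ (Set.Icc a b) := fun z hz =>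
    (hΦ z hz).continuousAt.continuousWithinAt
  have hΦcl : Set.MapsTo Φ (Set.Icc a b) (closure Ω) := by
    intro z hz
    rw [← hHcl] at hz hΦc
    exact closure_mono (Set.image_subset_iff.2 hmaps) (hΦc.image_closure ⟨z, hz, rfl⟩)
  have hΦ'c : ContinuousOn (fderiv ℝ Φ) (Set.Icc a b) := fun z hz =>
    ((hΦ z hz).fderiv_right (m := 1) (by norm_num)).continuousAt.continuousWithinAt
  set ξ : (Fin (m + 1) → ℝ) → (Fin (m + 1) → ℝ) [⋀^Fin m]→L[ℝ] ℂ := fun z =>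
    (ζ (Φ z)).compContinuousLinearMap (fderiv ℝ Φ z) with hξ
  have hξd : ∀ z ∈ H, extDeriv ξ z (fun j => Pi.single j 1) =
      ((σ : ℤ) : ℂ) * (|frameDet (fderiv ℝ Φ z)| • extDeriv ζ (Φ z) (stdFrame (m + 1))) := by
    intro z hz
    rw [hξ, extDeriv_pullback (hd _ (hmaps hz)) (hΦ z (hHs hz)) (by simp),
      ContinuousAlternatingMap.compContinuousLinearMap_apply, alternating_apply_eq_det_mul]
    change (frameDet (fderiv ℝ Φ z) : ℂ) * _ = _
    have h1 := hdet z hz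
    rw [Complex.real_smul, ← mul_assoc]
    congr 1
    rcases Int.units_eq_one_or σ with h | h <;> subst h
    · rw [abs_of_pos (by simpa using h1)]
      simp
    · rw [abs_of_neg (by simpa using h1)]
      simp
  have himg : Φ '' H ⊆ Ω := Set.image_subset_iff.2 hmaps
  have hint : IntegrableOn (fun z => |frameDet (fderiv ℝ Φ z)| •
      extDeriv ζ (Φ z) (stdFrame (m + 1))) H :=
    (integrableOn_image_iff_integrableOn_frameDet hHm hΦd hinj _).1 (hi.mono_set himg)
  -- The box theorem only asks for continuity of `ξ` on the closed box, and this is inherited from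
  -- `ζ` on `closure Ω`.
  have hbox := integral_extDeriv_box (fun i => (hab i).le) ξ ?_ ?_ ?_ ?_
  · have hcv := integral_image_eq_integral_frameDet hHm hΦd hinj
      fun x => extDeriv ζ x (stdFrame (m + 1))
    rw [setIntegral_congr_fun hHm hξd, integral_const_mul, ← hcv] at hbox
    rw [setIntegral_eq_of_subset_of_forall_sdiff_eq_zero hΩ.measurableSet himg
      (fun x hx => hsupp x hx.1 hx.2)]
    have hσ : ((σ : ℤ) : ℂ) * ((σ : ℤ) : ℂ) = 1 := by
      rcases Int.units_eq_one_or σ with h | h <;> subst h <;> simp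
    calc _ = ((σ : ℤ) : ℂ) * (((σ : ℤ) : ℂ) * ∫ x in Φ '' H, extDeriv ζ x (stdFrame (m + 1))) := by
          rw [← mul_assoc, hσ, one_mul]
      _ = _ := by
          rw [hbox]
          rfl
  · exact continuous_compContinuousLinearMap.comp_continuousOn
      ((hc.comp hΦc hΦcl).prodMk hΦ'c)
  · intro z hz
    exact ((hd _ (hmaps hz)).comp z (hΦd z hz).differentiableAt)
      |>.continuousAlternatingMapCompContinuousLinearMap
        (((hΦ z (hHs hz)).fderiv_right (m := 1) (by norm_num)).differentiableAt (by norm_num))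
  · exact (integrableOn_congr_fun hξd hHm).2 (hint.const_mul _)
  · intro z hz hz0
    simp only [hξ, h0 z hz hz0]
    rfl

end Chart

/-! ### Collars of the boundary patches -/

section Cube

variable {m : ℕ}

theorem isOpen_openCube (m : ℕ) : IsOpen (openCube m) :=
  isOpen_set_pi Set.finite_univ fun _ _ => isOpen_Ioo

theorem openCube_subset_closedCube (m : ℕ) : openCube m ⊆ closedCube m := by
  rw [closedCube, ← Set.pi_univ_Icc]
  exact Set.pi_mono fun _ _ => Set.Ioo_subset_Icc_self

theorem isCompact_closedCube (m : ℕ) : IsCompact (closedCube m) := isCompact_Icc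

theorem closedCube_mem_nhds {u : Fin m → ℝ} (hu : u ∈ openCube m) : closedCube m ∈ 𝓝 u :=
  mem_of_superset ((isOpen_openCube m).mem_nhds hu) (openCube_subset_closedCube m)

theorem IsPreconnected.subset_of_disjoint_frontier {X : Type*} [TopologicalSpace X] {s Ω : Set X}
    (hs : IsPreconnected s) (hΩ : IsOpen Ω) (hd : ∀ x ∈ s, x ∉ frontier Ω)
    (hne : (s ∩ Ω).Nonempty) : s ⊆ Ω := by
  refine hs.subset_left_of_subset_union hΩ isClosed_closure.isOpen_compl
    (Set.disjoint_left.2 fun x hx hx' => hx' (subset_closure hx)) (fun x hx => ?_) hne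
  by_contra h
  rw [Set.mem_union, not_or, Set.mem_compl_iff, not_not] at h
  exact hd x hx (by rw [hΩ.frontier_eq]; exact ⟨h.2, h.1⟩)

end Cube

section CollarChart

variable {m : ℕ}

/-- The map `(t, u) ↦ φ(u) + t ν`. -/
noncomputable def collar (φ : (Fin m → ℝ) → Euc (m + 1)) (ν : Euc (m + 1))
    (z : Fin (m + 1) → ℝ) : Euc (m + 1) :=
  φ (Fin.tail z) + z 0 • ν

variable {φ : (Fin m → ℝ) → Euc (m + 1)} {ν : Euc (m + 1)} {z : Fin (m + 1) → ℝ}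

theorem collar_cons (t : ℝ) (u : Fin m → ℝ) : collar φ ν (Fin.cons t u) = φ u + t • ν := by
  simp [collar]

theorem continuous_fin_tail : Continuous fun z : Fin (m + 1) → ℝ => Fin.tail z :=
  continuous_pi fun j => continuous_apply j.succ

theorem continuous_fin_cons :
    Continuous fun p : ℝ × (Fin m → ℝ) => (Fin.cons p.1 p.2 : Fin (m + 1) → ℝ) := by
  refine continuous_pi fun j => ?_
  refine Fin.cases ?_ (fun j => ?_) j
  · simpa using continuous_fst
  · exact (continuous_apply j).comp continuous_snd

theorem contDiffAt_collar (h : ContDiffAt ℝ ∞ φ (Fin.tail z)) : ContDiffAt ℝ ∞ (collar φ ν) z := by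
  have h1 : ContDiffAt ℝ ∞ (fun z : Fin (m + 1) → ℝ => Fin.tail z) z :=
    contDiffAt_pi.2 fun j => (contDiff_apply ℝ ℝ j.succ).contDiffAt
  exact (h.comp z h1).add ((contDiff_apply ℝ ℝ (0 : Fin (m + 1))).contDiffAt.smul contDiffAt_const)

theorem fderiv_collar (h : DifferentiableAt ℝ φ (Fin.tail z)) (v : Fin (m + 1) → ℝ) :
    fderiv ℝ (collar φ ν) z v = fderiv ℝ φ (Fin.tail z) (Fin.tail v) + v 0 • ν := by
  set T : (Fin (m + 1) → ℝ) →L[ℝ] (Fin m → ℝ) :=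
    ContinuousLinearMap.pi fun j => ContinuousLinearMap.proj j.succ
  have h1 : HasFDerivAt (fun z : Fin (m + 1) → ℝ => φ (Fin.tail z))
      ((fderiv ℝ φ (Fin.tail z)).comp T) z :=
    HasFDerivAt.comp z (g := φ) h.hasFDerivAt T.hasFDerivAt
  have h2 : HasFDerivAt (fun z : Fin (m + 1) → ℝ => z 0 • ν)
      ((ContinuousLinearMap.proj (R := ℝ) (φ := fun _ : Fin (m + 1) => ℝ) 0).smulRight ν) z :=
    ((ContinuousLinearMap.proj (R := ℝ) (φ := fun _ : Fin (m + 1) => ℝ) 0).smulRight ν).hasFDerivAt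
  have h3 : fderiv ℝ (collar φ ν) z = _ := (h1.add h2).fderiv
  rw [h3]
  rfl

theorem fderiv_collar_single_succ (h : DifferentiableAt ℝ φ (Fin.tail z)) (j : Fin m) :
    fderiv ℝ (collar φ ν) z (Pi.single j.succ 1) = patchTangent φ (Fin.tail z) j := by
  rw [fderiv_collar h, patchTangent]
  have : Fin.tail (Pi.single j.succ 1 : Fin (m + 1) → ℝ) = Pi.single j 1 := by
    funext i
    simp [Fin.tail, Pi.single_apply]
  rw [this]
  simp

/-- The columns of the Jacobian are `ν` and the tangent vectors, so the orientation condition in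
`outward` is the sign of this Jacobian. -/
theorem frameDet_fderiv_collar (h : DifferentiableAt ℝ φ (Fin.tail z)) :
    frameDet (fderiv ℝ (collar φ ν) z) = (EuclideanSpace.basisFun (Fin (m + 1)) ℝ).toBasis.det
      (Fin.cons ν (patchTangent φ (Fin.tail z))) := by
  rw [frameDet]
  congr 1
  funext j
  refine Fin.cases ?_ (fun j => ?_) j
  · rw [fderiv_collar h]
    have : Fin.tail (Pi.single 0 1 : Fin (m + 1) → ℝ) = 0 := by
      funext i
      simp [Fin.tail]
    simp [this]
  · rw [fderiv_collar_single_succ h, Fin.cons_succ]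

theorem continuous_frameDet {n : ℕ} : Continuous fun D : (Fin n → ℝ) →L[ℝ] Euc n => frameDet D := by
  simp only [frameDet_eq_det]
  exact ContinuousLinearMap.continuous_det.comp (by fun_prop)

/-- The inverse function theorem for maps with nonzero Jacobian determinant. -/
theorem exists_openPartialHomeomorph_of_frameDet_ne_zero {n : ℕ} {Φ : (Fin n → ℝ) → Euc n}
    {z : Fin n → ℝ} (hΦ : ContDiffAt ℝ 1 Φ z) (hdet : frameDet (fderiv ℝ Φ z) ≠ 0) :
    ∃ e : OpenPartialHomeomorph (Fin n → ℝ) (Euc n), z ∈ e.source ∧ ⇑e = Φ := by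
  rw [frameDet_eq_det] at hdet
  set T := EuclideanSpace.equiv (Fin n) ℝ
  set e := (ContinuousLinearMap.toContinuousLinearEquivOfDetNeZero _ hdet).trans T.symm
  have he : (e : (Fin n → ℝ) →L[ℝ] Euc n) = fderiv ℝ Φ z := by
    ext v
    simp [e]
  have h1 : HasStrictFDerivAt Φ (e : (Fin n → ℝ) →L[ℝ] Euc n) z := by
    rw [he]
    exact hΦ.hasStrictFDerivAt (by norm_num)
  exact ⟨h1.toOpenPartialHomeomorph Φ, h1.mem_toOpenPartialHomeomorph_source,
    h1.toOpenPartialHomeomorph_coe⟩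

end CollarChart

namespace PiecewiseSmoothBoundary

variable {m : ℕ} {Ω : Set (Euc (m + 1))} (B : PiecewiseSmoothBoundary Ω)

theorem patch_mem_frontier (i : B.ι) {u : Fin m → ℝ} (hu : u ∈ closedCube m) :
    B.patch i u ∈ frontier Ω := by
  rw [B.frontier_eq]
  exact Set.mem_iUnion.2 ⟨i, u, hu, rfl⟩

theorem contDiffAt_patch (i : B.ι) {u : Fin m → ℝ} (hu : u ∈ openCube m) :
    ContDiffAt ℝ ∞ (B.patch i) u :=
  (B.smooth i).contDiffAt (closedCube_mem_nhds hu)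

theorem isClosed_iUnion_patch_image {s : B.ι → Set (Fin m → ℝ)} (hs : ∀ i, IsClosed (s i))
    (hsub : ∀ i, s i ⊆ closedCube m) : IsClosed (⋃ i, B.patch i '' s i) :=
  (B.locallyFinite.subset fun i => Set.image_mono (hsub i)).isClosed_iUnion fun i =>
    (((isCompact_closedCube m).of_isClosed_subset (hs i) (hsub i)).image_of_continuousOn
      ((B.smooth i).continuousOn.mono (hsub i))).isClosed

/-- Delete `U` from the `i`-th parameter cube. What remains of all patches is a locally finite union
of compact sets, hence closed, and it misses `patch i u₀` by `nonoverlapping`. -/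
theorem eventually_frontier_subset_patch_image (i : B.ι) {u₀ : Fin m → ℝ} (hu₀ : u₀ ∈ openCube m)
    {U : Set (Fin m → ℝ)} (hU : IsOpen U) (huU : u₀ ∈ U) :
    ∀ᶠ y in 𝓝 (B.patch i u₀), y ∈ frontier Ω → ∃ u ∈ U, B.patch i u = y := by
  classical
  set s : B.ι → Set (Fin m → ℝ) := fun j => closedCube m \ if j = i then U else ∅
  have hs : ∀ j, IsClosed (s j) := by
    intro j
    refine (isCompact_closedCube m).isClosed.sdiff ?_
    split_ifs
    exacts [hU, isOpen_empty]
  have hcl := B.isClosed_iUnion_patch_image hs fun j => Set.sdiff_subset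
  have hp : B.patch i u₀ ∉ ⋃ j, B.patch j '' s j := by
    intro h
    obtain ⟨j, v, hv, hvp⟩ := Set.mem_iUnion.1 h
    obtain ⟨rfl, rfl⟩ := B.nonoverlapping i j u₀ hu₀ v hv.1 hvp.symm
    exact hv.2 (by simpa using huU)
  filter_upwards [hcl.isOpen_compl.mem_nhds hp] with y hy hyf
  rw [B.frontier_eq] at hyf
  obtain ⟨j, v, hv, hvy⟩ := Set.mem_iUnion.1 hyf
  by_cases hvs : v ∈ s j
  · exact (hy (Set.mem_iUnion.2 ⟨j, v, hvs, hvy⟩)).elim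
  · have hv2 : v ∈ if j = i then U else ∅ := by
      by_contra h
      exact hvs ⟨hv, h⟩
    split_ifs at hv2 with hji
    · subst hji
      exact ⟨v, hv2, hvy⟩
    · exact absurd hv2 (Set.notMem_empty _)

/-- The inverse function theorem makes the collar a local homeomorphism. Nearby frontier points lie
on `z 0 = 0`, so each open half of the ball is connected and avoids the frontier. The points `φ(u₀)
± tν` then decide which half is inside `Ω`. -/
theorem exists_collar_chart (hΩ : IsOpen Ω) (i : B.ι) {u₀ : Fin m → ℝ} (hu₀ : u₀ ∈ openCube m) :
    ∃ (ν : Euc (m + 1)) (r : ℝ), 0 < r ∧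
      (∀ z ∈ Metric.closedBall (Fin.cons 0 u₀ : Fin (m + 1) → ℝ) r, Fin.tail z ∈ openCube m) ∧
      Set.InjOn (collar (B.patch i) ν) (Metric.closedBall (Fin.cons 0 u₀) r) ∧
      IsOpen (collar (B.patch i) ν '' Metric.ball (Fin.cons 0 u₀) r) ∧
      (∀ z ∈ Metric.closedBall (Fin.cons 0 u₀ : Fin (m + 1) → ℝ) r,
        0 < ((B.sgn i : ℤ) : ℝ) * frameDet (fderiv ℝ (collar (B.patch i) ν) z)) ∧
      (∀ z ∈ Metric.ball (Fin.cons 0 u₀ : Fin (m + 1) → ℝ) r,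
        collar (B.patch i) ν z ∈ frontier Ω → z 0 = 0) ∧
      (∀ z ∈ Metric.ball (Fin.cons 0 u₀ : Fin (m + 1) → ℝ) r,
        collar (B.patch i) ν z ∈ Ω ↔ z 0 < 0) := by
  obtain ⟨ν, hdet, hside⟩ := B.outward i u₀ hu₀
  set φ := B.patch i
  set z₀ : Fin (m + 1) → ℝ := Fin.cons 0 u₀ with hz₀
  have htail : Fin.tail z₀ = u₀ := Fin.tail_cons _ _
  have hsm : ∀ z : Fin (m + 1) → ℝ, Fin.tail z ∈ openCube m → ContDiffAt ℝ ∞ (collar φ ν) z :=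
    fun z hz => contDiffAt_collar (B.contDiffAt_patch i hz)
  have hdiff : ∀ z : Fin (m + 1) → ℝ, Fin.tail z ∈ openCube m →
      DifferentiableAt ℝ φ (Fin.tail z) :=
    fun z hz => (B.contDiffAt_patch i hz).differentiableAt (by norm_num)
  have hz₀c : Fin.tail z₀ ∈ openCube m := htail ▸ hu₀
  have hdet0 : 0 < ((B.sgn i : ℤ) : ℝ) * frameDet (fderiv ℝ (collar φ ν) z₀) := by
    rw [frameDet_fderiv_collar (hdiff z₀ hz₀c), htail]
    exact hdet
  obtain ⟨e, hze, he⟩ := exists_openPartialHomeomorph_of_frameDet_ne_zero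
    ((hsm z₀ hz₀c).of_le (by norm_cast)) (right_ne_zero_of_mul hdet0.ne')
  have hcollar0 : collar φ ν z₀ = φ u₀ := by simp [hz₀, collar_cons]
  have hcons : Continuous fun u : Fin m → ℝ => (Fin.cons 0 u : Fin (m + 1) → ℝ) :=
    continuous_fin_cons.comp (by fun_prop : Continuous fun u : Fin m → ℝ => ((0 : ℝ), u))
  have hev : ∀ᶠ z : Fin (m + 1) → ℝ in 𝓝 z₀, Fin.tail z ∈ openCube m ∧ z ∈ e.source ∧
      0 < ((B.sgn i : ℤ) : ℝ) * frameDet (fderiv ℝ (collar φ ν) z) ∧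
      (collar φ ν z ∈ frontier Ω → ∃ u, (Fin.cons 0 u : Fin (m + 1) → ℝ) ∈ e.source ∧
        φ u = collar φ ν z) := by
    refine ((continuous_fin_tail.tendsto z₀).eventually ((isOpen_openCube m).mem_nhds hz₀c)).and
      (Filter.Eventually.and (e.open_source.mem_nhds hze) (Eventually.and ?_ ?_))
    · have h1 : ContinuousAt (fun z => ((B.sgn i : ℤ) : ℝ) * frameDet (fderiv ℝ (collar φ ν) z)) z₀ :=
        continuousAt_const.mul (continuous_frameDet.continuousAt.comp
          ((hsm z₀ hz₀c).fderiv_right (m := 1) (by norm_cast)).continuousAt)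
      exact h1.eventually (lt_mem_nhds hdet0)
    · have h1 := (hsm z₀ hz₀c).continuousAt
      rw [ContinuousAt, hcollar0] at h1
      exact h1.eventually (B.eventually_frontier_subset_patch_image i hu₀
        (e.open_source.preimage hcons) hze)
  obtain ⟨r, hr, hball⟩ := (Metric.nhds_basis_closedBall.eventually_iff).1 hev
  have hbb : Metric.ball z₀ r ⊆ Metric.closedBall z₀ r := Metric.ball_subset_closedBall
  have hinj : Set.InjOn (collar φ ν) e.source := he ▸ e.injOn
  -- A frontier point near `φ u₀` is also the collar image of some `(0, u)` in `e.source`, and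
  -- injectivity there forces `z = (0, u)`.
  have hfr : ∀ z ∈ Metric.ball z₀ r, collar φ ν z ∈ frontier Ω → z 0 = 0 := by
    intro z hz hzf
    obtain ⟨-, hzs, -, h⟩ := hball (hbb hz)
    obtain ⟨u, hu, hzu⟩ := h hzf
    have := hinj hu hzs (by rw [collar_cons, zero_smul, add_zero, hzu])
    rw [← this, Fin.cons_zero]
  have hcont : ContinuousOn (collar φ ν) (Metric.ball z₀ r) := fun z hz =>
    (hsm z (hball (hbb hz)).1).continuousAt.continuousWithinAt
  have hline : ∀ᶠ t : ℝ in 𝓝[>] 0, (Fin.cons t u₀ : Fin (m + 1) → ℝ) ∈ Metric.ball z₀ r ∧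
      (Fin.cons (-t) u₀ : Fin (m + 1) → ℝ) ∈ Metric.ball z₀ r := by
    have h1 : Continuous fun t : ℝ => (Fin.cons t u₀ : Fin (m + 1) → ℝ) :=
      continuous_fin_cons.comp (by fun_prop : Continuous fun t : ℝ => (t, u₀))
    have h2 : Continuous fun t : ℝ => (Fin.cons (-t) u₀ : Fin (m + 1) → ℝ) :=
      continuous_fin_cons.comp (by fun_prop : Continuous fun t : ℝ => (-t, u₀))
    refine nhdsWithin_le_nhds ((h1.tendsto' 0 z₀ rfl |>.eventually (Metric.ball_mem_nhds z₀ hr)).and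
      (h2.tendsto' 0 z₀ (by simp [hz₀]) |>.eventually (Metric.ball_mem_nhds z₀ hr)))
  obtain ⟨t, ⟨⟨hout, hin⟩, htp, htn⟩, ht0⟩ :=
    ((hside.and hline).and self_mem_nhdsWithin).exists
  have ht0 : (0 : ℝ) < t := ht0
  -- A convex piece of the ball off the hyperplane `z 0 = 0` lies in `Ω` as soon as its image meets
  -- `Ω`.
  have hconv : ∀ s : Set (Fin (m + 1) → ℝ), Convex ℝ s → (∀ z ∈ s, z 0 ≠ 0) →
      (collar φ ν '' (Metric.ball z₀ r ∩ s) ∩ Ω).Nonempty →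
      collar φ ν '' (Metric.ball z₀ r ∩ s) ⊆ Ω := by
    intro s hs hs0 hne
    refine IsPreconnected.subset_of_disjoint_frontier ?_ hΩ ?_ hne
    · exact ((convex_ball z₀ r).inter hs).isPreconnected.image _
        (hcont.mono Set.inter_subset_left)
    · rintro - ⟨z, hz, rfl⟩ hzf
      exact hs0 z hz.2 (hfr z hz.1 hzf)
  have hneg := hconv {z | z 0 < 0}
    (convex_halfSpace_lt (f := fun z : Fin (m + 1) → ℝ => z 0) ⟨fun _ _ => rfl, fun _ _ => rfl⟩ 0)
    (fun z hz => (show z 0 < 0 from hz).ne)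
    ⟨_, ⟨_, ⟨htn, by simpa using ht0⟩, rfl⟩, by
      rw [collar_cons, neg_smul, ← sub_eq_add_neg]; exact hin⟩
  have hpos := hconv {z | 0 < z 0}
    (convex_halfSpace_gt (f := fun z : Fin (m + 1) → ℝ => z 0) ⟨fun _ _ => rfl, fun _ _ => rfl⟩ 0)
    (fun z hz => (show 0 < z 0 from hz).ne')
  refine ⟨ν, r, hr, fun z hz => (hball hz).1, hinj.mono fun z hz => (hball hz).2.1, ?_,
    fun z hz => (hball hz).2.2.1, hfr, fun z hz => ⟨fun hzΩ => ?_, fun hz0 => ?_⟩⟩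
  · rw [← he]
    exact e.isOpen_image_of_subset_source Metric.isOpen_ball fun z hz => (hball (hbb hz)).2.1
  · by_contra hz0
    rcases (not_lt.1 hz0).eq_or_lt with h0 | h0
    · have h1 : collar φ ν z ∈ frontier Ω := by
        rw [collar, ← h0, zero_smul, add_zero]
        exact B.patch_mem_frontier i (openCube_subset_closedCube m (hball (hbb hz)).1)
      rw [hΩ.frontier_eq] at h1
      exact h1.2 hzΩ
    -- If the outer half met `Ω`, it would lie in `Ω` entirely, including the point `φ(u₀) + tν`
    -- known to be outside.
    · refine hout ?_
      rw [← collar_cons]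
      exact hpos ⟨_, ⟨z, ⟨hz, h0⟩, rfl⟩, hzΩ⟩ ⟨_, ⟨htp, by simpa using ht0⟩, rfl⟩
  · exact hneg ⟨z, ⟨hz, hz0⟩, rfl⟩

end PiecewiseSmoothBoundary

/-! ### Multiplying forms by cutoff functions -/

section Cutoff

variable {m : ℕ}

/-- The coefficient of the `(m+1)`-form `dχ ∧ η`. -/
noncomputable def gradWedge (χ : Euc (m + 1) → ℝ) (η : DiffForm (m + 1) m)
    (x : Euc (m + 1)) : ℂ :=
  ∑ i : Fin (m + 1), (-1) ^ (i : ℕ) * ((fderiv ℝ χ x (basisVec i) : ℝ) : ℂ) *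
    η x (i.removeNth (stdFrame (m + 1)))

theorem norm_gradWedge_le (χ : Euc (m + 1) → ℝ) (η : DiffForm (m + 1) m) (x : Euc (m + 1)) :
    ‖gradWedge χ η x‖ ≤ (m + 1) * (‖fderiv ℝ χ x‖ * ‖η x‖) := by
  have h : ∀ i : Fin (m + 1), ‖(-1) ^ (i : ℕ) * ((fderiv ℝ χ x (basisVec i) : ℝ) : ℂ) *
      η x (i.removeNth (stdFrame (m + 1)))‖ ≤ ‖fderiv ℝ χ x‖ * ‖η x‖ := by
    intro i
    rw [norm_mul, norm_mul, norm_pow, norm_neg, norm_one, one_pow, one_mul, Complex.norm_real]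
    gcongr
    · simpa [norm_basisVec] using (fderiv ℝ χ x).le_opNorm (basisVec i)
    · exact norm_alternating_apply_le _ _ fun j => norm_basisVec _
  refine (norm_sum_le _ _).trans ((Finset.sum_le_sum fun i _ => h i).trans_eq ?_)
  simp

theorem aestronglyMeasurable_gradWedge {Ω : Set (Euc (m + 1))} {χ : Euc (m + 1) → ℝ}
    (hχ : Continuous (fderiv ℝ χ)) {η : DiffForm (m + 1) m}
    (hη : AEStronglyMeasurable η (volume.restrict Ω)) :
    AEStronglyMeasurable (gradWedge χ η) (volume.restrict Ω) := by
  refine Finset.aestronglyMeasurable_fun_sum _ fun i _ => AEStronglyMeasurable.mul ?_ ?_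
  · have : Continuous fun x => (-1 : ℂ) ^ (i : ℕ) * ((fderiv ℝ χ x (basisVec i) : ℝ) : ℂ) := by
      fun_prop
    exact this.aestronglyMeasurable
  · exact (ContinuousAlternatingMap.apply ℝ _ ℂ _).continuous.comp_aestronglyMeasurable hη

theorem integrableOn_gradWedge {Ω : Set (Euc (m + 1))} {χ : Euc (m + 1) → ℝ}
    (hχ : Continuous (fderiv ℝ χ)) {C : ℝ} (hC : ∀ x, ‖fderiv ℝ χ x‖ ≤ C)
    {η : DiffForm (m + 1) m} (hη : IntegrableOn η Ω) : IntegrableOn (gradWedge χ η) Ω := by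
  refine (hη.norm.const_mul ((m + 1) * C)).mono'
    (aestronglyMeasurable_gradWedge hχ hη.aestronglyMeasurable) (Eventually.of_forall fun x => ?_)
  refine (norm_gradWedge_le χ η x).trans ?_
  rw [mul_assoc]
  gcongr
  exact hC x

theorem extDeriv_cutoff {χ : Euc (m + 1) → ℝ} {η : DiffForm (m + 1) m} {x : Euc (m + 1)}
    (hχ : DifferentiableAt ℝ χ x) (hη : DifferentiableAt ℝ η x) :
    extDeriv (fun y => χ y • η y) x (stdFrame (m + 1)) =
      gradWedge χ η x + χ x * extDeriv η x (stdFrame (m + 1)) :=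
  extDeriv_smul_apply hχ hη _

theorem integrableOn_cutoff_mul {Ω : Set (Euc (m + 1))} {χ : Euc (m + 1) → ℝ} (hχ : Continuous χ)
    {C : ℝ} (hC : ∀ x, ‖χ x‖ ≤ C) {f : Euc (m + 1) → ℂ} (hf : IntegrableOn f Ω) :
    IntegrableOn (fun x => χ x * f x) Ω :=
  Integrable.bdd_mul (c := C) hf (by fun_prop : Continuous fun x => (χ x : ℂ)).aestronglyMeasurable
    (Eventually.of_forall fun x => by rw [Complex.norm_real]; exact hC x)

theorem exists_bound_of_hasCompactSupport {χ : Euc (m + 1) → ℝ} (hχ : ContDiff ℝ 1 χ)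
    (hχc : HasCompactSupport χ) :
    Continuous (fderiv ℝ χ) ∧ (∃ C, ∀ x, ‖fderiv ℝ χ x‖ ≤ C) ∧ ∃ C, ∀ x, ‖χ x‖ ≤ C := by
  have h1 := hχ.continuous_fderiv (by norm_num)
  exact ⟨h1, h1.bounded_above_of_compact_support (hχc.fderiv ℝ),
    hχ.continuous.bounded_above_of_compact_support hχc⟩

theorem integrableOn_extDeriv_cutoff {Ω : Set (Euc (m + 1))} (hΩ : IsOpen Ω)
    {χ : Euc (m + 1) → ℝ} (hχ : ContDiff ℝ 1 χ) (hχc : HasCompactSupport χ)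
    {η : DiffForm (m + 1) m} (hd : ∀ x ∈ Ω, DifferentiableAt ℝ η x) (hη : IntegrableOn η Ω)
    (hdη : IntegrableOn (fun x => extDeriv η x (stdFrame (m + 1))) Ω) :
    IntegrableOn (fun x => extDeriv (fun y => χ y • η y) x (stdFrame (m + 1))) Ω := by
  obtain ⟨h1, ⟨C, hC⟩, C', hC'⟩ := exists_bound_of_hasCompactSupport hχ hχc
  exact (integrableOn_congr_fun (fun x hx => extDeriv_cutoff
    ((hχ.differentiable (by norm_num)) x) (hd x hx)) hΩ.measurableSet).2
    ((integrableOn_gradWedge h1 hC hη).add (integrableOn_cutoff_mul hχ.continuous hC' hdη))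

theorem extDeriv_cutoff_of_notMem_tsupport {χ : Euc (m + 1) → ℝ} {η : DiffForm (m + 1) m}
    {x : Euc (m + 1)} (hx : x ∉ tsupport χ) :
    extDeriv (fun y => χ y • η y) x = 0 := by
  have h : (fun y => χ y • η y) =ᶠ[𝓝 x] fun _ => 0 := by
    filter_upwards [notMem_tsupport_iff_eventuallyEq.1 hx] with y hy
    rw [hy]
    exact zero_smul ℝ (η y)
  rw [h.extDeriv_eq, extDeriv, fderiv_fun_const]
  ext v
  simp [ContinuousAlternatingMap.alternatizeUncurryFin_apply]

end Cutoff

/-! ### Local Stokes' theorem at a smooth boundary point -/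

namespace PiecewiseSmoothBoundary

variable {m : ℕ} {Ω : Set (Euc (m + 1))} (B : PiecewiseSmoothBoundary Ω)

/-- Stokes' theorem for a form supported near an interior point of a patch. -/
theorem exists_nhds_stokes_of_mem_openCube (hΩ : IsOpen Ω) {η : DiffForm (m + 1) m}
    (hc : ContinuousOn η (closure Ω)) (hd : ∀ x ∈ Ω, DifferentiableAt ℝ η x)
    (hη : IntegrableOn η Ω) (hdη : IntegrableOn (fun x => extDeriv η x (stdFrame (m + 1))) Ω)
    (i : B.ι) {u₀ : Fin m → ℝ} (hu₀ : u₀ ∈ openCube m) :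
    ∃ N ∈ 𝓝 (B.patch i u₀), ∀ χ : Euc (m + 1) → ℝ, ContDiff ℝ 1 χ → HasCompactSupport χ →
      tsupport χ ⊆ N → B.formIntegral (fun y => χ y • η y) =
        ∫ x in Ω, extDeriv (fun y => χ y • η y) x (stdFrame (m + 1)) := by
  obtain ⟨ν, r, hr, htail, hinj, hopen, hdet, hfr, hside⟩ := B.exists_collar_chart hΩ i hu₀
  set φ := B.patch i with hφ
  set z₀ : Fin (m + 1) → ℝ := Fin.cons 0 u₀ with hz₀
  have hz₀b : z₀ ∈ Metric.ball z₀ r := Metric.mem_ball_self hr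
  refine ⟨collar φ ν '' Metric.ball z₀ r, hopen.mem_nhds ⟨z₀, hz₀b, by simp [hz₀, collar_cons]⟩,
    fun χ hχ hχc hχN => ?_⟩
  have hχ0 : ∀ y, y ∉ collar φ ν '' Metric.ball z₀ r → χ y = 0 := fun y hy =>
    image_eq_zero_of_notMem_tsupport fun h => hy (hχN h)
  -- In the sup metric the ball is a cube. The box is its half `z 0 ≤ 0`, and its face `z 0 = 0`
  -- parametrises the boundary piece.
  set a : Fin (m + 1) → ℝ := Fin.cons (-r) fun j => u₀ j - r with ha
  set b : Fin (m + 1) → ℝ := Fin.cons 0 fun j => u₀ j + r with hb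
  have hball : ∀ z : Fin (m + 1) → ℝ, z ∈ Metric.ball z₀ r ↔
      |z 0| < r ∧ ∀ j : Fin m, |z j.succ - u₀ j| < r := fun z => by
    rw [Metric.mem_ball, dist_pi_lt_iff hr, Fin.forall_fin_succ]
    simp [hz₀, Real.dist_eq]
  have hcball : ∀ z : Fin (m + 1) → ℝ, z ∈ Metric.closedBall z₀ r ↔
      |z 0| ≤ r ∧ ∀ j : Fin m, |z j.succ - u₀ j| ≤ r := fun z => by
    rw [Metric.mem_closedBall, dist_pi_le_iff hr.le, Fin.forall_fin_succ]
    simp [hz₀, Real.dist_eq]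
  have hIcc : ∀ z : Fin (m + 1) → ℝ, z ∈ Set.Icc a b ↔
      z ∈ Metric.closedBall z₀ r ∧ z 0 ≤ 0 := fun z => by
    rw [hcball, Set.mem_Icc, Pi.le_def, Pi.le_def, Fin.forall_fin_succ, Fin.forall_fin_succ]
    simp only [ha, hb, Fin.cons_zero, Fin.cons_succ, abs_le]
    constructor
    · rintro ⟨⟨h1, h2⟩, h3, h4⟩
      exact ⟨⟨⟨h1, h3.trans hr.le⟩, fun j => ⟨by linarith [h2 j], by linarith [h4 j]⟩⟩, h3⟩
    · rintro ⟨⟨⟨h1, h2⟩, h3⟩, h4⟩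
      exact ⟨⟨h1, fun j => by linarith [h3 j]⟩, h4, fun j => by linarith [h3 j]⟩
  have hIoo : ∀ z : Fin (m + 1) → ℝ, z ∈ Set.univ.pi (fun i => Set.Ioo (a i) (b i)) ↔
      z ∈ Metric.ball z₀ r ∧ z 0 < 0 := fun z => by
    rw [hball, Set.mem_univ_pi, Fin.forall_fin_succ]
    simp only [ha, hb, Fin.cons_zero, Fin.cons_succ, abs_lt, Set.mem_Ioo]
    constructor
    · rintro ⟨⟨h1, h2⟩, h3⟩
      exact ⟨⟨⟨h1, h2.trans hr⟩, fun j => ⟨by linarith [h3 j], by linarith [h3 j]⟩⟩, h2⟩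
    · rintro ⟨⟨⟨h1, h2⟩, h3⟩, h4⟩
      exact ⟨⟨h1, h4⟩, fun j => ⟨by linarith [h3 j], by linarith [h3 j]⟩⟩
  have hbb : Metric.ball z₀ r ⊆ Metric.closedBall z₀ r := Metric.ball_subset_closedBall
  have hsm : ∀ z ∈ Metric.closedBall z₀ r, ContDiffAt ℝ ∞ (collar φ ν) z := fun z hz =>
    contDiffAt_collar (B.contDiffAt_patch i (htail z hz))
  -- Injectivity on the closed ball keeps images of its boundary out of the image of the open ball,
  -- which contains the support of `χ`. So the cut-off form vanishes on every face except `z 0 = 0`.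
  have hoff : ∀ z ∈ Metric.closedBall z₀ r, z ∉ Metric.ball z₀ r → χ (collar φ ν z) = 0 := by
    intro z hz hzb
    refine hχ0 _ ?_
    rintro ⟨w, hw, hwz⟩
    exact hzb (hinj (hbb hw) hz hwz ▸ hw)
  -- On the support of `χ` the boundary consists of the `i`-th patch over the face alone, so one
  -- term of `formIntegral` remains.
  have hpatch : ∀ j, ∀ v ∈ closedCube m, χ (B.patch j v) ≠ 0 →
      i = j ∧ v ∈ Set.Icc (Fin.tail a) (Fin.tail b) := by
    intro j v hv hne
    have hmem : B.patch j v ∈ collar φ ν '' Metric.ball z₀ r := by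
      by_contra h
      exact hne (hχ0 _ h)
    obtain ⟨z, hz, hzv⟩ := hmem
    have hz0 : z 0 = 0 := hfr z hz (hzv ▸ B.patch_mem_frontier j hv)
    rw [collar, hz0, zero_smul, add_zero] at hzv
    obtain ⟨hij, hzv'⟩ := B.nonoverlapping i j _ (htail z (hbb hz)) v hv hzv
    refine ⟨hij, ?_⟩
    have := (hIcc z).2 ⟨hbb hz, hz0.le⟩
    rw [← hzv']
    exact ⟨fun j => this.1 j.succ, fun j => this.2 j.succ⟩
  have hcons : ∀ u ∈ Set.Icc (Fin.tail a) (Fin.tail b),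
      (Fin.cons 0 u : Fin (m + 1) → ℝ) ∈ Metric.closedBall z₀ r := by
    intro u hu
    rw [hcball]
    refine ⟨by simpa using hr.le, fun j => ?_⟩
    have h1 := hu.1 j
    have h2 := hu.2 j
    simp only [ha, hb, Fin.tail_cons] at h1 h2
    rw [Fin.cons_succ, abs_le]
    constructor <;> linarith
  have hsub : Set.Icc (Fin.tail a) (Fin.tail b) ⊆ openCube m := fun u hu => by
    simpa using htail _ (hcons u hu)
  have hmain := integral_extDeriv_eq_of_chart hΩ (Φ := collar φ ν) (a := a) (b := b)
    (ζ := fun y => χ y • η y) ?_ ?_ ?_ (B.sgn i) ?_ ?_ ?_ ?_ ?_ ?_ ?_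
  · rw [hmain, formIntegral, tsum_eq_single i]
    · congr 1
      rw [setIntegral_eq_of_subset_of_forall_sdiff_eq_zero (isOpen_openCube m).measurableSet hsub]
      · refine setIntegral_congr_fun measurableSet_Icc fun u hu => ?_
        have hdu : DifferentiableAt ℝ φ (Fin.tail (Fin.cons (b 0) u : Fin (m + 1) → ℝ)) := by
          rw [Fin.tail_cons]
          exact (B.contDiffAt_patch i (hsub hu)).differentiableAt (by norm_num)
        simp only [fderiv_collar_single_succ hdu]
        simp only [hb, Fin.cons_zero, collar_cons, zero_smul, add_zero, Fin.tail_cons]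
        rfl
      · rintro u ⟨hu, hu'⟩
        by_cases hne : χ (B.patch i u) = 0
        · simp [pullback, hne]
        · exact absurd (hpatch i u (openCube_subset_closedCube m hu) hne).2 hu'
    · intro j hj
      rw [setIntegral_congr_fun (g := fun _ => 0) (isOpen_openCube m).measurableSet, integral_zero,
        mul_zero]
      intro v hv
      by_cases hne : χ (B.patch j v) = 0
      · simp [pullback, hne]
      · exact absurd (hpatch j v (openCube_subset_closedCube m hv) hne).1.symm hj
  · rw [Fin.forall_fin_succ]
    simp only [ha, hb, Fin.cons_zero, Fin.cons_succ]
    exact ⟨by linarith, fun j => by linarith⟩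
  · intro z hz
    exact (hsm z ((hIcc z).1 hz).1).of_le (by norm_cast)
  · exact hinj.mono fun z hz => hbb ((hIoo z).1 hz).1
  · exact fun z hz => hdet z (hbb ((hIoo z).1 hz).1)
  · exact fun z hz => (hside z ((hIoo z).1 hz).1).2 ((hIoo z).1 hz).2
  · exact hχ.continuous.continuousOn.smul hc
  · exact fun x hx => (hχ.differentiable (by norm_num) x).smul (hd x hx)
  · exact integrableOn_extDeriv_cutoff hΩ hχ hχc hd hη hdη
  · intro z hz hface
    have hzc := ((hIcc z).1 hz).1
    have hzb : z ∉ Metric.ball z₀ r := by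
      rw [hball]
      rintro ⟨h1, h2⟩
      rcases hface with h | ⟨j, hj, h⟩
      · rw [h] at h1
        simp [ha, abs_of_pos hr] at h1
      · obtain ⟨j, rfl⟩ := Fin.exists_succ_eq.2 hj
        have h3 := h2 j
        rcases h with h | h <;> rw [h] at h3 <;> simp [ha, hb, abs_of_pos hr] at h3
    simp only [hoff z hzc hzb]
    exact zero_smul ℝ (η (collar φ ν z))
  · intro x hx hxH
    rw [extDeriv_cutoff_of_notMem_tsupport]
    · rfl
    · intro hxt
      obtain ⟨z, hz, rfl⟩ := hχN hxt
      exact hxH ⟨z, (hIoo z).2 ⟨hz, (hside z hz).1 hx⟩, rfl⟩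

end PiecewiseSmoothBoundary

/-! ### Forms compactly supported inside the domain -/

section Interior

variable {m : ℕ} {Ω : Set (Euc (m + 1))}

theorem integral_fderiv_apply_eq_zero {g : Euc (m + 1) → ℂ} (hg : ContDiff ℝ 1 g)
    (hgc : HasCompactSupport g) (v : Euc (m + 1)) : ∫ x, fderiv ℝ g x v = 0 := by
  have h1 : Continuous fun x => fderiv ℝ g x v :=
    (hg.continuous_fderiv (by norm_num)).clm_apply continuous_const
  have h2 : Integrable fun x => fderiv ℝ g x v :=
    h1.integrable_of_hasCompactSupport (hgc.fderiv_apply ℝ v)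
  have h := integral_mul_fderiv_eq_neg_fderiv_mul_of_integrable (μ := volume)
    (f := fun _ : Euc (m + 1) => (1 : ℂ)) (g := g) (v := v) (by simp) (by simpa using h2)
    (by simpa using hg.continuous.integrable_of_hasCompactSupport hgc)
    (fun _ _ => differentiableAt_const _) (fun x _ => hg.differentiable (by norm_num) x)
  simpa using h

/-- Extended by zero the form is `C¹` on the whole space, and each component of its differential is
a derivative of a compactly supported function. -/
theorem integral_extDeriv_cutoff_eq_zero (hΩ : IsOpen Ω) {η : DiffForm (m + 1) m}
    (hd : ContDiffOn ℝ 1 η Ω) {χ : Euc (m + 1) → ℝ} (hχ : ContDiff ℝ 1 χ)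
    (hχc : HasCompactSupport χ) (hχΩ : tsupport χ ⊆ Ω) :
    ∫ x in Ω, extDeriv (fun y => χ y • η y) x (stdFrame (m + 1)) = 0 := by
  set ζ : DiffForm (m + 1) m := fun y => χ y • η y with hζ
  have hsupp : ∀ x, x ∉ tsupport χ → ζ =ᶠ[𝓝 x] fun _ => 0 := by
    intro x hx
    filter_upwards [notMem_tsupport_iff_eventuallyEq.1 hx] with y hy
    rw [hζ]
    simp only [hy]
    exact zero_smul ℝ (η y)
  have hζd : ContDiff ℝ 1 ζ := by
    rw [contDiff_iff_contDiffAt]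
    intro x
    by_cases hx : x ∈ tsupport χ
    · exact hχ.contDiffAt.smul (hd.contDiffAt (hΩ.mem_nhds (hχΩ hx)))
    · exact contDiffAt_const.congr_of_eventuallyEq (hsupp x hx)
  have hcomp : ∀ v : Fin m → Euc (m + 1), ContDiff ℝ 1 (fun x => ζ x v) ∧
      HasCompactSupport fun x => ζ x v := by
    refine fun v => ⟨(ContinuousAlternatingMap.apply ℝ _ ℂ v).contDiff.comp hζd, ?_⟩
    refine hχc.mono fun x hx hx0 => hx ?_
    have : ζ x = 0 := by
      rw [hζ]
      simp only [hx0]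
      exact zero_smul ℝ (η x)
    simp [this]
  rw [setIntegral_eq_integral_of_forall_compl_eq_zero]
  · have h1 : ∀ x, extDeriv ζ x (stdFrame (m + 1)) = ∑ i : Fin (m + 1), (-1 : ℂ) ^ (i : ℕ) *
        fderiv ℝ (fun y => ζ y (i.removeNth (stdFrame (m + 1)))) x (stdFrame (m + 1) i) :=
      fun x => by
        rw [extDeriv_apply (hζd.differentiable (by norm_num) x)]
        simp
    simp only [h1]
    rw [integral_finsetSum]
    · refine Finset.sum_eq_zero fun i _ => ?_
      rw [integral_const_mul, integral_fderiv_apply_eq_zero (hcomp _).1 (hcomp _).2, mul_zero]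
    · intro i _
      exact (((hcomp _).1.continuous_fderiv (by norm_num)).clm_apply
        continuous_const).integrable_of_hasCompactSupport ((hcomp _).2.fderiv_apply ℝ _) |>.const_mul _
  · intro x hx
    rw [extDeriv_cutoff_of_notMem_tsupport fun h => hx (hχΩ h)]
    rfl

end Interior

/-! ### Gluing away from the edges -/

namespace PiecewiseSmoothBoundary

variable {m : ℕ} {Ω : Set (Euc (m + 1))} (B : PiecewiseSmoothBoundary Ω)

theorem pullback_cutoff (χ : Euc (m + 1) → ℝ) (η : DiffForm (m + 1) m) (i : B.ι) (u : Fin m → ℝ) :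
    B.pullback (fun y => χ y • η y) i u = (χ (B.patch i u) : ℂ) * B.pullback η i u := by
  rw [← Complex.real_smul]
  rfl

theorem integrableOn_pullback_cutoff {η : DiffForm (m + 1) m} (hη : B.FormIntegrable η)
    {χ : Euc (m + 1) → ℝ} (hχ : Continuous χ) {C : ℝ} (hC : ∀ x, ‖χ x‖ ≤ C) (i : B.ι) :
    IntegrableOn (B.pullback (fun y => χ y • η y) i) (openCube m) := by
  have h1 : AEStronglyMeasurable (fun u => (χ (B.patch i u) : ℂ))
      (volume.restrict (openCube m)) := by
    have : ContinuousOn (fun u => (χ (B.patch i u) : ℂ)) (openCube m) :=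
      Complex.continuous_ofReal.comp_continuousOn (hχ.comp_continuousOn
        ((B.smooth i).continuousOn.mono (openCube_subset_closedCube m)))
    exact this.aestronglyMeasurable (isOpen_openCube m).measurableSet
  refine ((hη.1 i).bdd_mul (c := C) h1 (Eventually.of_forall fun u => ?_)).congr
    (Eventually.of_forall fun u => (B.pullback_cutoff χ η i u).symm)
  rw [Complex.norm_real]
  exact hC _

theorem norm_integral_pullback_cutoff_le {η : DiffForm (m + 1) m} (hη : B.FormIntegrable η)
    {χ : Euc (m + 1) → ℝ} {C : ℝ} (hC : ∀ x, ‖χ x‖ ≤ C) (i : B.ι) :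
    ‖((B.sgn i : ℤ) : ℂ) * ∫ u in openCube m, B.pullback (fun y => χ y • η y) i u‖ ≤
      C * ∫ u in openCube m, ‖B.pullback η i u‖ := by
  have hσ : ‖((B.sgn i : ℤ) : ℂ)‖ = 1 := by
    rcases Int.units_eq_one_or (B.sgn i) with h | h <;> simp [h]
  rw [norm_mul, hσ, one_mul, ← integral_const_mul]
  refine norm_integral_le_of_norm_le ((hη.1 i).norm.const_mul C) (Eventually.of_forall fun u => ?_)
  rw [pullback_cutoff, norm_mul, Complex.norm_real]
  exact mul_le_mul_of_nonneg_right (hC _) (norm_nonneg _)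

theorem summable_pullback_cutoff {η : DiffForm (m + 1) m} (hη : B.FormIntegrable η)
    {χ : Euc (m + 1) → ℝ} {C : ℝ} (hC : ∀ x, ‖χ x‖ ≤ C) :
    Summable fun i => ((B.sgn i : ℤ) : ℂ) *
      ∫ u in openCube m, B.pullback (fun y => χ y • η y) i u :=
  Summable.of_norm_bounded (hη.2.mul_left C) fun i =>
    B.norm_integral_pullback_cutoff_le hη hC i

theorem formIntegral_cutoff_add {η : DiffForm (m + 1) m} (hη : B.FormIntegrable η)
    {χ₁ χ₂ : Euc (m + 1) → ℝ} (hχ₁ : Continuous χ₁) {C₁ : ℝ} (hC₁ : ∀ x, ‖χ₁ x‖ ≤ C₁)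
    (hχ₂ : Continuous χ₂) {C₂ : ℝ} (hC₂ : ∀ x, ‖χ₂ x‖ ≤ C₂) :
    B.formIntegral (fun y => (χ₁ y + χ₂ y) • η y) =
      B.formIntegral (fun y => χ₁ y • η y) + B.formIntegral (fun y => χ₂ y • η y) := by
  rw [formIntegral, formIntegral, formIntegral, ← Summable.tsum_add
    (B.summable_pullback_cutoff hη hC₁) (B.summable_pullback_cutoff hη hC₂)]
  congr 1 with i
  rw [← mul_add, ← integral_add (B.integrableOn_pullback_cutoff hη hχ₁ hC₁ i)
    (B.integrableOn_pullback_cutoff hη hχ₂ hC₂ i)]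
  congr 2 with u
  rw [B.pullback_cutoff (fun y => χ₁ y + χ₂ y), pullback_cutoff, pullback_cutoff]
  push_cast
  ring

/-- Dominated convergence twice, in the sum over patches and in each integral. Convergence is needed
only over open cubes, so the cutoffs may vanish on the edges. -/
theorem tendsto_formIntegral_cutoff {η : DiffForm (m + 1) m} (hη : B.FormIntegrable η)
    {χ : ℕ → Euc (m + 1) → ℝ} (hχ : ∀ N, Continuous (χ N)) {C : ℝ} (hC : ∀ N x, ‖χ N x‖ ≤ C)
    {χ' : Euc (m + 1) → ℝ}
    (hlim : ∀ i, ∀ u ∈ openCube m,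
      Tendsto (fun N => χ N (B.patch i u)) atTop (𝓝 (χ' (B.patch i u)))) :
    Tendsto (fun N => B.formIntegral fun y => χ N y • η y) atTop
      (𝓝 (B.formIntegral fun y => χ' y • η y)) := by
  refine tendsto_tsum_of_dominated_convergence (hη.2.mul_left C) (fun i => ?_)
    (Eventually.of_forall fun N i => B.norm_integral_pullback_cutoff_le hη (hC N) i)
  refine Tendsto.const_mul _ ?_
  refine tendsto_integral_of_dominated_convergence (fun u => C * ‖B.pullback η i u‖)
    (fun N => (B.integrableOn_pullback_cutoff hη (hχ N) (hC N) i).aestronglyMeasurable)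
    ((hη.1 i).norm.const_mul C) (fun N => Eventually.of_forall fun u => ?_) ?_
  · rw [pullback_cutoff, norm_mul, Complex.norm_real]
    exact mul_le_mul_of_nonneg_right (hC _ _) (norm_nonneg _)
  · filter_upwards [ae_restrict_mem (isOpen_openCube m).measurableSet] with u hu
    simp only [pullback_cutoff]
    exact ((Complex.continuous_ofReal.tendsto _).comp (hlim i u hu)).mul_const _

/-- The union of the images of the boundary of the cube. -/
def edges : Set (Euc (m + 1)) := ⋃ i, B.patch i '' (closedCube m \ openCube m)

theorem patch_notMem_edges (i : B.ι) {u : Fin m → ℝ} (hu : u ∈ openCube m) :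
    B.patch i u ∉ B.edges := by
  intro h
  obtain ⟨j, v, hv, hvu⟩ := Set.mem_iUnion.1 h
  obtain ⟨rfl, rfl⟩ := B.nonoverlapping i j u hu v hv.1 hvu.symm
  exact hv.2 hu

theorem edges_subset_frontier : B.edges ⊆ frontier Ω := by
  intro y hy
  obtain ⟨j, v, hv, rfl⟩ := Set.mem_iUnion.1 hy
  exact B.patch_mem_frontier j hv.1

theorem formIntegral_cutoff_eq_zero {χ : Euc (m + 1) → ℝ} {η : DiffForm (m + 1) m}
    (hχ : ∀ x ∈ frontier Ω, χ x = 0) : B.formIntegral (fun y => χ y • η y) = 0 := by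
  rw [formIntegral, tsum_congr (g := fun _ => 0), tsum_zero]
  intro i
  rw [setIntegral_congr_fun (g := fun _ => 0) (isOpen_openCube m).measurableSet, integral_zero,
    mul_zero]
  intro u hu
  simp [pullback_cutoff, hχ _ (B.patch_mem_frontier i (openCube_subset_closedCube m hu))]

/-- A point off the edges is in `Ω`, outside `closure Ω`, or in the open cube of a patch. In the
first two cases both sides are zero; the third is the collar argument. -/
theorem exists_nhds_stokes (hΩ : IsOpen Ω) {η : DiffForm (m + 1) m}
    (hc : ContinuousOn η (closure Ω)) (hd : ContDiffOn ℝ 1 η Ω)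
    (hη : IntegrableOn η Ω) (hdη : IntegrableOn (fun x => extDeriv η x (stdFrame (m + 1))) Ω)
    {p : Euc (m + 1)} (hp : p ∉ B.edges) :
    ∃ N ∈ 𝓝 p, ∀ χ : Euc (m + 1) → ℝ, ContDiff ℝ 1 χ → HasCompactSupport χ →
      tsupport χ ⊆ N → B.formIntegral (fun y => χ y • η y) =
        ∫ x in Ω, extDeriv (fun y => χ y • η y) x (stdFrame (m + 1)) := by
  have hd' : ∀ x ∈ Ω, DifferentiableAt ℝ η x := fun x hx =>
    (hd.contDiffAt (hΩ.mem_nhds hx)).differentiableAt (by norm_num)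
  by_cases hpΩ : p ∈ Ω
  · refine ⟨Ω, hΩ.mem_nhds hpΩ, fun χ hχ hχc hχN => ?_⟩
    rw [integral_extDeriv_cutoff_eq_zero hΩ hd hχ hχc hχN, B.formIntegral_cutoff_eq_zero]
    intro x hx
    rw [hΩ.frontier_eq] at hx
    exact image_eq_zero_of_notMem_tsupport fun h => hx.2 (hχN h)
  by_cases hpc : p ∈ closure Ω
  · have hpf : p ∈ frontier Ω := by
      rw [hΩ.frontier_eq]
      exact ⟨hpc, hpΩ⟩
    rw [B.frontier_eq] at hpf
    obtain ⟨i, u, hu, rfl⟩ := Set.mem_iUnion.1 hpf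
    have huo : u ∈ openCube m := by
      by_contra h
      exact hp (Set.mem_iUnion.2 ⟨i, u, ⟨hu, h⟩, rfl⟩)
    exact B.exists_nhds_stokes_of_mem_openCube hΩ hc hd' hη hdη i huo
  · refine ⟨(closure Ω)ᶜ, isClosed_closure.isOpen_compl.mem_nhds hpc, fun χ hχ hχc hχN => ?_⟩
    rw [B.formIntegral_cutoff_eq_zero, setIntegral_congr_fun (g := fun _ => 0) hΩ.measurableSet,
      integral_zero]
    · intro x hx
      simp only
      rw [extDeriv_cutoff_of_notMem_tsupport fun h => hχN h (subset_closure hx)]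
      rfl
    · exact fun x hx => image_eq_zero_of_notMem_tsupport fun h => hχN h (frontier_subset_closure hx)

theorem integral_extDeriv_cutoff_add (hΩ : IsOpen Ω) {η : DiffForm (m + 1) m}
    (hd : ∀ x ∈ Ω, DifferentiableAt ℝ η x)
    (hη : IntegrableOn η Ω) (hdη : IntegrableOn (fun x => extDeriv η x (stdFrame (m + 1))) Ω)
    {χ₁ χ₂ : Euc (m + 1) → ℝ} (hχ₁ : ContDiff ℝ 1 χ₁) (hc₁ : HasCompactSupport χ₁)
    (hχ₂ : ContDiff ℝ 1 χ₂) (hc₂ : HasCompactSupport χ₂) :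
    ∫ x in Ω, extDeriv (fun y => (χ₁ y + χ₂ y) • η y) x (stdFrame (m + 1)) =
      (∫ x in Ω, extDeriv (fun y => χ₁ y • η y) x (stdFrame (m + 1))) +
        ∫ x in Ω, extDeriv (fun y => χ₂ y • η y) x (stdFrame (m + 1)) := by
  rw [← integral_add (integrableOn_extDeriv_cutoff hΩ hχ₁ hc₁ hd hη hdη)
    (integrableOn_extDeriv_cutoff hΩ hχ₂ hc₂ hd hη hdη)]
  refine setIntegral_congr_fun hΩ.measurableSet fun x hx => ?_
  have h : (fun y => (χ₁ y + χ₂ y) • η y) = fun y => χ₁ y • η y + χ₂ y • η y := by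
    funext y
    exact add_smul (χ₁ y) (χ₂ y) (η y)
  simp only [h]
  rw [extDeriv_fun_add ((hχ₁.differentiable (by norm_num) x).fun_smul (hd x hx))
    ((hχ₂.differentiable (by norm_num) x).fun_smul (hd x hx))]
  rfl

/-- Stokes' theorem for a compactly supported form vanishing near the edges of the patches. -/
theorem stokes_of_disjoint_edges (hΩ : IsOpen Ω) {η : DiffForm (m + 1) m}
    (hc : ContinuousOn η (closure Ω)) (hd : ContDiffOn ℝ 1 η Ω)
    (hη : IntegrableOn η Ω) (hdη : IntegrableOn (fun x => extDeriv η x (stdFrame (m + 1))) Ω)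
    (hbd : B.FormIntegrable η) {χ : Euc (m + 1) → ℝ} (hχ : ContDiff ℝ 1 χ)
    (hχc : HasCompactSupport χ) (hdisj : ∀ x ∈ tsupport χ, x ∉ B.edges) :
    B.formIntegral (fun y => χ y • η y) =
      ∫ x in Ω, extDeriv (fun y => χ y • η y) x (stdFrame (m + 1)) := by
  have hd' : ∀ x ∈ Ω, DifferentiableAt ℝ η x := fun x hx =>
    (hd.contDiffAt (hΩ.mem_nhds hx)).differentiableAt (by norm_num)
  -- Compactness induction in place of a partition of unity. Requiring the formula for `h * ψ` with
  -- every `ψ` makes the property stable under unions, through `h + g * (1 - h)`.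
  have key : ∃ h : Euc (m + 1) → ℝ, ContDiff ℝ 1 h ∧ (∀ x ∈ tsupport χ, h x = 1) ∧
      ∀ ψ : Euc (m + 1) → ℝ, ContDiff ℝ 1 ψ → HasCompactSupport ψ →
        B.formIntegral (fun y => (h y * ψ y) • η y) =
          ∫ x in Ω, extDeriv (fun y => (h y * ψ y) • η y) x (stdFrame (m + 1)) := by
    refine IsCompact.induction_on (s := tsupport χ) hχc ?_ ?_ ?_ ?_
    · refine ⟨fun _ => 0, contDiff_const, by simp, fun ψ hψ hψc => ?_⟩
      rw [integral_extDeriv_cutoff_eq_zero hΩ hd (by simp only [zero_mul]; exact contDiff_const)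
        (by simp only [zero_mul]; exact HasCompactSupport.zero)
        (by simp [tsupport]), B.formIntegral_cutoff_eq_zero]
      simp
    · rintro s t hst ⟨h, h1, h2, h3⟩
      exact ⟨h, h1, fun x hx => h2 x (hst hx), h3⟩
    · rintro s t ⟨h, h1, h2, h3⟩ ⟨g, g1, g2, g3⟩
      refine ⟨fun x => h x + g x * (1 - h x), h1.add (g1.mul (contDiff_const.sub h1)), ?_,
        fun ψ hψ hψc => ?_⟩
      · rintro x (hx | hx)
        · simp [h2 x hx]
        · simp [g2 x hx]
      · have e1 : (fun y => ((h y + g y * (1 - h y)) * ψ y) • η y) =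
            fun y => (h y * ψ y + g y * ((1 - h y) * ψ y)) • η y := by
          funext y
          congr 1
          ring
        have d1 : ContDiff ℝ 1 fun y => h y * ψ y := h1.mul hψ
        have d2 : ContDiff ℝ 1 fun y => (1 - h y) * ψ y := (contDiff_const.sub h1).mul hψ
        have d3 : ContDiff ℝ 1 fun y => g y * ((1 - h y) * ψ y) := g1.mul d2
        have c1 : HasCompactSupport fun y => h y * ψ y := hψc.mul_left
        have c2 : HasCompactSupport fun y => (1 - h y) * ψ y := hψc.mul_left
        have c3 : HasCompactSupport fun y => g y * ((1 - h y) * ψ y) := c2.mul_left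
        obtain ⟨-, -, C₁, hC₁⟩ := exists_bound_of_hasCompactSupport d1 c1
        obtain ⟨-, -, C₃, hC₃⟩ := exists_bound_of_hasCompactSupport d3 c3
        rw [e1, B.formIntegral_cutoff_add hbd d1.continuous hC₁ d3.continuous hC₃,
          integral_extDeriv_cutoff_add hΩ hd' hη hdη d1 c1 d3 c3, h3 ψ hψ hψc, g3 _ d2 c2]
    · intro p hp
      obtain ⟨N, hN, hst⟩ := B.exists_nhds_stokes hΩ hc hd hη hdη (hdisj p hp)
      obtain ⟨r, hr, hrN⟩ := Metric.nhds_basis_closedBall.mem_iff.1 hN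
      let f : ContDiffBump p := ⟨r / 2, r, by positivity, by linarith⟩
      refine ⟨Metric.closedBall p (r / 2), nhdsWithin_le_nhds
        (Metric.closedBall_mem_nhds p (by positivity)), f, f.contDiff, fun x hx =>
          f.one_of_mem_closedBall hx, fun ψ hψ hψc => ?_⟩
      refine hst _ (f.contDiff.mul hψ) hψc.mul_left ?_
      exact (tsupport_mul_subset_left).trans (f.tsupport_eq.trans_subset hrN)
  obtain ⟨h, -, h1, h2⟩ := key
  have h3 := h2 χ hχ hχc
  have h4 : ∀ y, h y * χ y = χ y := fun y => by
    by_cases hy : y ∈ tsupport χ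
    · rw [h1 y hy, one_mul]
    · rw [image_eq_zero_of_notMem_tsupport hy, mul_zero]
  simpa only [h4] using h3

end PiecewiseSmoothBoundary

/-! ### Covering the edges by few small balls -/

section SmallCover

variable {m : ℕ}

/-- A subset of `ℝ^{m+1}` covered, for each `N ≥ 1`, by `O(N^{m-1})` balls of radius `O(1/N)`
centred on it. -/
def SmallCover (Z : Set (Euc (m + 1))) : Prop :=
  ∃ K : ℝ, 0 < K ∧ ∀ N : ℕ, 0 < N → ∃ t : Finset (Euc (m + 1)),
    (t.card : ℝ) * (N : ℝ)⁻¹ ^ m ≤ K * (N : ℝ)⁻¹ ∧ (∀ c ∈ t, c ∈ Z) ∧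
      ∀ z ∈ Z, ∃ c ∈ t, dist z c < K * (N : ℝ)⁻¹

theorem smallCover_empty : SmallCover (∅ : Set (Euc (m + 1))) :=
  ⟨1, one_pos, fun N _ => ⟨∅, by simp⟩⟩

theorem SmallCover.union {Z W : Set (Euc (m + 1))} (hZ : SmallCover Z) (hW : SmallCover W) :
    SmallCover (Z ∪ W) := by
  classical
  obtain ⟨K, hK, h⟩ := hZ
  obtain ⟨L, hL, g⟩ := hW
  refine ⟨K + L, add_pos hK hL, fun N hN => ?_⟩
  obtain ⟨t, t1, t2, t3⟩ := h N hN
  obtain ⟨s, s1, s2, s3⟩ := g N hN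
  have hN' : 0 < (N : ℝ)⁻¹ := by positivity
  refine ⟨t ∪ s, ?_, ?_, ?_⟩
  · have h1 : ((t ∪ s).card : ℝ) ≤ t.card + s.card := by exact_mod_cast Finset.card_union_le t s
    calc _ ≤ ((t.card : ℝ) + s.card) * (N : ℝ)⁻¹ ^ m := by gcongr
      _ ≤ _ := by rw [add_mul, add_mul]; exact add_le_add t1 s1
  · intro c hc
    rcases Finset.mem_union.1 hc with h | h
    exacts [Or.inl (t2 c h), Or.inr (s2 c h)]
  · rintro z (hz | hz)
    · obtain ⟨c, hc, hd⟩ := t3 z hz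
      exact ⟨c, Finset.mem_union_left _ hc, hd.trans_le (by gcongr; linarith)⟩
    · obtain ⟨c, hc, hd⟩ := s3 z hz
      exact ⟨c, Finset.mem_union_right _ hc, hd.trans_le (by gcongr; linarith)⟩

theorem smallCover_biUnion {ι : Type*} {s : Set ι} (hs : s.Finite) {Z : ι → Set (Euc (m + 1))}
    (hZ : ∀ i ∈ s, SmallCover (Z i)) : SmallCover (⋃ i ∈ s, Z i) := by
  induction s, hs using Set.Finite.induction_on with
  | empty => simpa using smallCover_empty
  | insert _ _ ih =>
    rw [Set.biUnion_insert]
    exact (hZ _ (Set.mem_insert _ _)).union (ih fun i hi => hZ i (Set.mem_insert_of_mem _ hi))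

theorem exists_fin_dist_le {N : ℕ} (hN : 0 < N) {t : ℝ} (ht : t ∈ Set.Icc (0 : ℝ) 1) :
    ∃ k : Fin (N + 1), |t - (k : ℝ) * (N : ℝ)⁻¹| ≤ (N : ℝ)⁻¹ := by
  have hN' : (0 : ℝ) < N := by exact_mod_cast hN
  have h0 : 0 ≤ t * N := mul_nonneg ht.1 hN'.le
  have h1 : ⌊t * N⌋₊ ≤ N := by
    have : t * N ≤ N := mul_le_of_le_one_left hN'.le ht.2
    exact_mod_cast (Nat.floor_le h0).trans this
  refine ⟨⟨⌊t * N⌋₊, Nat.lt_succ_of_le h1⟩, ?_⟩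
  have h2 := Nat.floor_le h0
  have h3 := Nat.lt_floor_add_one (t * N)
  have h4 : t - (⌊t * N⌋₊ : ℝ) * (N : ℝ)⁻¹ = (t * N - ⌊t * N⌋₊) * (N : ℝ)⁻¹ := by
    field_simp
  simp only
  rw [h4, abs_of_nonneg (mul_nonneg (by linarith) (by positivity))]
  exact mul_le_of_le_one_left (by positivity) (by linarith)

/-- The patch is Lipschitz on the compact convex cube. Grid points of mesh `1/N` on the faces number
`(n + 1) * 2 * (N + 1)^n`, and their images are the centres. -/
theorem smallCover_image_cube_boundary {φ : (Fin m → ℝ) → Euc (m + 1)}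
    (hφ : ContDiffOn ℝ ∞ φ (closedCube m)) : SmallCover (φ '' (closedCube m \ openCube m)) := by
  classical
  obtain ⟨L, hL⟩ : ∃ L, LipschitzOnWith L φ (closedCube m) :=
    (hφ.of_le (by norm_cast : (1 : WithTop ℕ∞) ≤ ∞)).exists_lipschitzOnWith one_ne_zero
      (convex_Icc _ _) (isCompact_closedCube m)
  cases m with
  | zero =>
    -- A zero-dimensional cube is a point and has no boundary.
    have : closedCube 0 \ openCube 0 = ∅ := by
      ext u
      simp [openCube]
    rw [this, Set.image_empty]
    exact smallCover_empty
  | succ n =>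
    -- The first summand bounds the number of centres, via `N + 1 ≤ 2N`; `L` bounds the distances,
    -- and `1` makes that bound strict.
    refine ⟨(n + 1) * 2 * 2 ^ n + L + 1, by positivity, fun N hN => ?_⟩
    have hN' : (0 : ℝ) < N := by exact_mod_cast hN
    have hN1 : (1 : ℝ) ≤ N := by exact_mod_cast hN
    set pt : Fin (n + 1) × Bool × (Fin n → Fin (N + 1)) → Fin (n + 1) → ℝ := fun p =>
      p.1.insertNth (if p.2.1 then 1 else 0) fun i => (p.2.2 i : ℝ) * (N : ℝ)⁻¹ with hpt
    have hptm : ∀ p, pt p ∈ closedCube (n + 1) \ openCube (n + 1) := by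
      rintro ⟨j, b, g⟩
      refine ⟨?_, fun h => ?_⟩
      · rw [closedCube, Fin.insertNth_mem_Icc]
        refine ⟨by cases b <;> simp, fun i => by simp; positivity, fun i => ?_⟩
        have : ((g i : ℕ) : ℝ) ≤ N := by exact_mod_cast Nat.lt_succ_iff.1 (g i).2
        simpa using mul_inv_le_one_of_le₀ this hN'.le
      · have := h j (Set.mem_univ j)
        simp only [hpt, Fin.insertNth_apply_same] at this
        cases b <;> simp at this
    refine ⟨Finset.univ.image fun p => φ (pt p), ?_, ?_, ?_⟩
    · have h1 : ((Finset.univ.image fun p => φ (pt p)).card : ℝ) ≤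
          (n + 1) * (2 * (N + 1) ^ n) := by
        have : (Finset.univ.image fun p => φ (pt p)).card ≤ (n + 1) * (2 * (N + 1) ^ n) := by
          refine Finset.card_image_le.trans_eq ?_
          simp [Fintype.card_prod]
        exact_mod_cast this
      calc _ ≤ ((n + 1 : ℝ) * (2 * (N + 1) ^ n)) * (N : ℝ)⁻¹ ^ (n + 1) := by gcongr
        _ ≤ ((n + 1 : ℝ) * (2 * (2 * N) ^ n)) * (N : ℝ)⁻¹ ^ (n + 1) := by gcongr; linarith
        _ = ((n + 1) * 2 * 2 ^ n) * (N : ℝ)⁻¹ := by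
          rw [mul_pow, pow_succ, inv_pow]
          field_simp
        _ ≤ _ := by
          gcongr
          have : (0 : ℝ) ≤ L := L.2
          linarith
    · intro c hc
      obtain ⟨p, -, rfl⟩ := Finset.mem_image.1 hc
      exact ⟨_, hptm p, rfl⟩
    · rintro - ⟨u, ⟨huc, huo⟩, rfl⟩
      have hu01 : ∀ i, u i ∈ Set.Icc (0 : ℝ) 1 := fun i => ⟨huc.1 i, huc.2 i⟩
      obtain ⟨j, hj⟩ : ∃ j, u j ∉ Set.Ioo (0 : ℝ) 1 := by
        by_contra! h
        exact huo fun j _ => h j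
      obtain ⟨b, hb⟩ : ∃ b : Bool, u j = if b then 1 else 0 := by
        rcases eq_or_ne (u j) 0 with h0 | h0
        · exact ⟨false, by simpa using h0⟩
        · refine ⟨true, ?_⟩
          by_contra h1
          exact hj ⟨lt_of_le_of_ne (hu01 j).1 h0.symm, lt_of_le_of_ne (hu01 j).2 (by simpa using h1)⟩
      choose g hg using fun i : Fin n => exists_fin_dist_le hN (hu01 (j.succAbove i))
      refine ⟨_, Finset.mem_image_of_mem _ (Finset.mem_univ (j, b, g)), ?_⟩
      have hd : dist u (pt (j, b, g)) ≤ (N : ℝ)⁻¹ := by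
        refine (dist_pi_le_iff (by positivity)).2 fun i => ?_
        rcases Fin.eq_self_or_eq_succAbove j i with rfl | ⟨i, rfl⟩
        · simp only [hpt, Fin.insertNth_apply_same]
          rw [hb, dist_self]
          positivity
        · simp only [hpt, Fin.insertNth_apply_succAbove]
          exact hg i
      have h2 := hL.dist_le_mul u huc _ (hptm (j, b, g)).1
      refine h2.trans_lt ?_
      have h3 : (0 : ℝ) < (N : ℝ)⁻¹ := by positivity
      have h4 : (0 : ℝ) ≤ (n + 1) * 2 * 2 ^ n := by positivity
      calc (L : ℝ) * dist u (pt (j, b, g)) ≤ L * (N : ℝ)⁻¹ := by gcongr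
        _ < _ := by
          gcongr
          linarith

end SmallCover

/-! ### Cutoffs vanishing near the edges with small gradient -/

section EdgeCutoff

variable {m : ℕ}

theorem norm_fderiv_prod_le {E ι : Type*} [NormedAddCommGroup E] [NormedSpace ℝ E]
    (t : Finset ι) {f : ι → E → ℝ} {x : E}
    (hf : ∀ c ∈ t, DifferentiableAt ℝ (f c) x) (h1 : ∀ c ∈ t, |f c x| ≤ 1) :
    ‖fderiv ℝ (fun y => ∏ c ∈ t, f c y) x‖ ≤ ∑ c ∈ t, ‖fderiv ℝ (f c) x‖ := by
  classical
  have h := HasFDerivAt.finsetProd fun c hc => (hf c hc).hasFDerivAt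
  rw [h.fderiv]
  refine (norm_sum_le _ _).trans (Finset.sum_le_sum fun c _ => ?_)
  rw [norm_smul, Real.norm_eq_abs, Finset.abs_prod]
  exact mul_le_of_le_one_left (norm_nonneg _)
    (Finset.prod_le_one (fun _ _ => abs_nonneg _) fun j hj => h1 j (Finset.mem_of_mem_erase hj))

/-- The bump function of radius `r` centred at `c`. -/
noncomputable def scaledBump (c : Euc (m + 1)) (r : ℝ) (x : Euc (m + 1)) : ℝ :=
  (⟨1, 2, one_pos, one_lt_two⟩ : ContDiffBump (0 : Euc (m + 1))) (r⁻¹ • (x - c))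

section

variable (c : Euc (m + 1)) {r : ℝ} (x : Euc (m + 1))

theorem contDiff_scaledBump : ContDiff ℝ 1 (scaledBump c r) :=
  (ContDiffBump.contDiff _).comp (by fun_prop)

theorem scaledBump_nonneg : 0 ≤ scaledBump c r x := ContDiffBump.nonneg _

theorem scaledBump_le_one : scaledBump c r x ≤ 1 := ContDiffBump.le_one _

variable {x}

theorem scaledBump_eq_one (hr : 0 < r) (hx : dist x c ≤ r) : scaledBump c r x = 1 := by
  refine ContDiffBump.one_of_mem_closedBall _ ?_
  rw [mem_closedBall_zero_iff, norm_smul, norm_inv, Real.norm_eq_abs, abs_of_pos hr,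
    inv_mul_le_iff₀ hr, mul_one, ← dist_eq_norm]
  exact hx

theorem scaledBump_eq_zero (hr : 0 < r) (hx : 2 * r ≤ dist x c) : scaledBump c r x = 0 := by
  refine ContDiffBump.zero_of_le_dist _ ?_
  rw [dist_zero_right, norm_smul, norm_inv, Real.norm_eq_abs, abs_of_pos hr, le_inv_mul_iff₀ hr,
    ← dist_eq_norm, mul_comm]
  exact hx

theorem hasCompactSupport_scaledBump (hr : 0 < r) : HasCompactSupport (scaledBump c r) := by
  refine HasCompactSupport.intro (isCompact_closedBall c (2 * r)) fun x hx => ?_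
  exact scaledBump_eq_zero c hr (not_le.1 hx).le

end

/-- Scaling: the gradient has size `1/r` on a region of volume of order `r^{m+1}`. The `L¹` bound
serves small `r` at the edges, the uniform bound serves large `r` at infinity. -/
theorem exists_norm_fderiv_scaledBump_le (m : ℕ) :
    ∃ M : ℝ, 0 ≤ M ∧ ∀ (c : Euc (m + 1)) (r : ℝ), 0 < r →
      (∀ x, ‖fderiv ℝ (scaledBump c r) x‖ ≤ M * r⁻¹) ∧
      Integrable (fun x => ‖fderiv ℝ (scaledBump c r) x‖) ∧
      ∫ x, ‖fderiv ℝ (scaledBump c r) x‖ ≤ M * r ^ m := by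
  set b : ContDiffBump (0 : Euc (m + 1)) := ⟨1, 2, one_pos, one_lt_two⟩ with hb
  have hbs : ContDiff ℝ 1 b := b.contDiff
  have hbc : HasCompactSupport b := b.hasCompactSupport
  have hcont : Continuous (fderiv ℝ b) := hbs.continuous_fderiv (by norm_num)
  obtain ⟨M, hM⟩ := hcont.bounded_above_of_compact_support (hbc.fderiv ℝ)
  have hint : Integrable (fun x => ‖fderiv ℝ b x‖) :=
    hcont.norm.integrable_of_hasCompactSupport (hbc.fderiv ℝ).norm
  refine ⟨max M (∫ x, ‖fderiv ℝ b x‖), le_max_of_le_right (integral_nonneg fun _ => norm_nonneg _),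
    fun c r hr => ?_⟩
  have hfd : ∀ x, ‖fderiv ℝ (scaledBump c r) x‖ = r⁻¹ * ‖fderiv ℝ b (r⁻¹ • (x - c))‖ := by
    intro x
    have h1 : HasFDerivAt (fun x : Euc (m + 1) => r⁻¹ • (x - c))
        (r⁻¹ • ContinuousLinearMap.id ℝ (Euc (m + 1))) x :=
      ((hasFDerivAt_id x).sub_const c).const_smul r⁻¹
    have h2 : HasFDerivAt (scaledBump c r) _ x :=
      (hbs.differentiable (by norm_num) (r⁻¹ • (x - c))).hasFDerivAt.comp x h1
    rw [h2.fderiv, ContinuousLinearMap.comp_smul, norm_smul, ContinuousLinearMap.comp_id, norm_inv,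
      Real.norm_eq_abs, abs_of_pos hr]
  refine ⟨fun x => ?_, ?_, ?_⟩
  · rw [hfd, mul_comm]
    gcongr
    exact (hM _).trans (le_max_left _ _)
  · simp only [hfd]
    exact ((hint.comp_smul (inv_ne_zero hr.ne')).comp_sub_right c).const_mul _
  · simp only [hfd]
    rw [integral_const_mul, integral_sub_right_eq_self (fun x => ‖fderiv ℝ b (r⁻¹ • x)‖) c,
      Measure.integral_comp_inv_smul (μ := volume) (fun x => ‖fderiv ℝ b x‖) r,
      finrank_euclideanSpace_fin, abs_of_pos (pow_pos hr _), smul_eq_mul, ← mul_assoc, pow_succ,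
      mul_comm (r ^ m), inv_mul_cancel_left₀ hr.ne', mul_comm]
    gcongr
    exact le_max_right _ _

/-- Take the product over the centres of one minus a bump of radius `r`. The gradient has `L¹` norm
at most the number of centres times `M * r^m`, which is `O(r)`. As the centres lie on the closed set
`Z`, a point off `Z` is eventually untouched. -/
theorem SmallCover.exists_cutoff {Z : Set (Euc (m + 1))} (hZ : SmallCover Z) (hZc : IsClosed Z) :
    ∃ χ : ℕ → Euc (m + 1) → ℝ, (∀ N, ContDiff ℝ 1 (χ N)) ∧ (∀ N x, ‖χ N x‖ ≤ 1) ∧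
      (∀ N, ∀ z ∈ Z, z ∉ tsupport (χ N)) ∧
      (∀ x, x ∉ Z → Tendsto (fun N => χ N x) atTop (𝓝 1)) ∧
      (∀ N, Integrable fun x => ‖fderiv ℝ (χ N) x‖) ∧
      Tendsto (fun N => ∫ x, ‖fderiv ℝ (χ N) x‖) atTop (𝓝 0) := by
  obtain ⟨K, hK, h⟩ := hZ
  obtain ⟨M, hM0, hM⟩ := exists_norm_fderiv_scaledBump_le m
  -- The index is shifted because covers exist only for positive `N`.
  choose t ht1 ht2 ht3 using fun N : ℕ => h (N + 1) N.succ_pos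
  set r : ℕ → ℝ := fun N => K * ((N + 1 : ℕ) : ℝ)⁻¹ with hr
  have hr0 : ∀ N, 0 < r N := fun N => by positivity
  have hrlim : Tendsto r atTop (𝓝 0) := by
    have h1 := ((tendsto_inv_atTop_zero (𝕜 := ℝ)).comp
      (tendsto_natCast_atTop_atTop.comp (tendsto_add_atTop_nat 1))).const_mul K
    simpa [hr, Function.comp_def] using h1
  have hd : ∀ N (c : Euc (m + 1)), Differentiable ℝ fun x => 1 - scaledBump c (r N) x := fun N c =>
    (differentiable_const _).sub ((contDiff_scaledBump c).differentiable (by norm_num))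
  have hfd : ∀ N (c x : Euc (m + 1)), ‖fderiv ℝ (fun x => 1 - scaledBump c (r N) x) x‖ =
      ‖fderiv ℝ (scaledBump c (r N)) x‖ := by
    intro N c x
    rw [fderiv_const_sub, norm_neg]
  have habs : ∀ N (c x : Euc (m + 1)), |1 - scaledBump c (r N) x| ≤ 1 := fun N c x => by
    have h1 := scaledBump_nonneg c (r := r N) x
    have h2 := scaledBump_le_one c (r := r N) x
    rw [abs_le]
    constructor <;> linarith
  set χ : ℕ → Euc (m + 1) → ℝ := fun N x => ∏ c ∈ t N, (1 - scaledBump c (r N) x) with hχ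
  have hχd : ∀ N, ContDiff ℝ 1 (χ N) := fun N =>
    contDiff_prod fun c _ => contDiff_const.sub (contDiff_scaledBump c)
  have hχb : ∀ N x, ‖fderiv ℝ (χ N) x‖ ≤ ∑ c ∈ t N, ‖fderiv ℝ (scaledBump c (r N)) x‖ := by
    intro N x
    refine (norm_fderiv_prod_le (t N) (fun c _ => hd N c x) fun c _ => habs N c x).trans_eq ?_
    exact Finset.sum_congr rfl fun c _ => hfd N c x
  have hsumi : ∀ N, Integrable fun x => ∑ c ∈ t N, ‖fderiv ℝ (scaledBump c (r N)) x‖ := fun N =>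
    integrable_finsetSum _ fun c _ => (hM c _ (hr0 N)).2.1
  have hχi : ∀ N, Integrable fun x => ‖fderiv ℝ (χ N) x‖ := fun N => by
    refine (hsumi N).mono' ((hχd N).continuous_fderiv (by norm_num)).norm.aestronglyMeasurable
      (Eventually.of_forall fun x => ?_)
    rw [norm_norm]
    exact hχb N x
  refine ⟨χ, hχd, fun N x => ?_, fun N z hz => ?_, fun x hx => ?_, hχi, ?_⟩
  · rw [Real.norm_eq_abs, hχ]
    simp only
    rw [Finset.abs_prod]
    exact Finset.prod_le_one (fun _ _ => abs_nonneg _) fun c _ => habs N c x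
  · obtain ⟨c, hc, hzc⟩ := ht3 N z hz
    rw [notMem_tsupport_iff_eventuallyEq]
    filter_upwards [Metric.isOpen_ball.mem_nhds (Metric.mem_ball.2 hzc)] with y hy
    exact Finset.prod_eq_zero hc (by
      rw [scaledBump_eq_one c (hr0 N) (Metric.mem_ball.1 hy).le, sub_self])
  · refine tendsto_const_nhds.congr' ?_
    obtain ⟨δ, hδ, hball⟩ := Metric.isOpen_iff.1 hZc.isOpen_compl x hx
    filter_upwards [hrlim.eventually (gt_mem_nhds (half_pos hδ))] with N hN
    refine (Finset.prod_eq_one fun c hc => ?_).symm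
    rw [scaledBump_eq_zero c (hr0 N), sub_zero]
    by_contra hlt
    refine hball (Metric.mem_ball'.2 ?_) (ht2 N c hc)
    linarith
  · have hlim : Tendsto (fun N => M * K ^ m * r N) atTop (𝓝 0) := by
      simpa using hrlim.const_mul (M * K ^ m)
    refine squeeze_zero (fun N => integral_nonneg fun _ => norm_nonneg _) (fun N => ?_) hlim
    calc ∫ x, ‖fderiv ℝ (χ N) x‖ ≤ ∫ x, ∑ c ∈ t N, ‖fderiv ℝ (scaledBump c (r N)) x‖ :=
          integral_mono (hχi N) (hsumi N) (hχb N)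
      _ = ∑ c ∈ t N, ∫ x, ‖fderiv ℝ (scaledBump c (r N)) x‖ :=
          integral_finsetSum _ fun c _ => (hM c _ (hr0 N)).2.1
      _ ≤ ∑ c ∈ t N, M * r N ^ m := Finset.sum_le_sum fun c _ => (hM c _ (hr0 N)).2.2
      _ = M * K ^ m * ((t N).card * ((N + 1 : ℕ) : ℝ)⁻¹ ^ m) := by
          rw [Finset.sum_const, nsmul_eq_mul, hr]
          simp only
          rw [mul_pow]
          ring
      _ ≤ _ := by
          gcongr
          exact ht1 N

end EdgeCutoff

/-! ### Passing to the limit in the cutoffs -/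

section Limits

variable {m : ℕ}

theorem gradWedge_mul {χ ψ : Euc (m + 1) → ℝ} {x : Euc (m + 1)} (hχ : DifferentiableAt ℝ χ x)
    (hψ : DifferentiableAt ℝ ψ x) (η : DiffForm (m + 1) m) :
    gradWedge (fun y => ψ y * χ y) η x =
      ψ x * gradWedge χ η x + χ x * gradWedge ψ η x := by
  simp only [gradWedge, Finset.mul_sum, ← Finset.sum_add_distrib]
  refine Finset.sum_congr rfl fun i _ => ?_
  rw [fderiv_fun_mul hψ hχ]
  simp only [add_apply, smul_apply, smul_eq_mul]
  push_cast
  ring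

theorem norm_integral_cutoff_gradWedge_le {Ω K : Set (Euc (m + 1))} {χ ψ : Euc (m + 1) → ℝ}
    (hψ : ∀ x, ‖ψ x‖ ≤ 1) (hψK : ∀ x, x ∉ K → ψ x = 0)
    (hχ : Integrable fun x => ‖fderiv ℝ χ x‖) {η : DiffForm (m + 1) m} {C : ℝ} (hC0 : 0 ≤ C)
    (hC : ∀ x ∈ K ∩ Ω, ‖η x‖ ≤ C) (hΩ : MeasurableSet Ω) :
    ‖∫ x in Ω, (ψ x : ℂ) * gradWedge χ η x‖ ≤ ((m + 1) * C) * ∫ x, ‖fderiv ℝ χ x‖ := by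
  rw [← integral_const_mul]
  refine (norm_integral_le_of_norm_le (hχ.integrableOn.const_mul ((m + 1) * C)) ?_).trans
    (setIntegral_le_integral (hχ.const_mul _) (Eventually.of_forall fun x => by
      simp only [Pi.zero_apply]; positivity))
  filter_upwards [ae_restrict_mem hΩ] with x hx
  rw [norm_mul, Complex.norm_real]
  by_cases hxK : x ∈ K
  · calc ‖ψ x‖ * ‖gradWedge χ η x‖ ≤ 1 * ((m + 1) * (‖fderiv ℝ χ x‖ * ‖η x‖)) := by
          gcongr
          exacts [hψ x, norm_gradWedge_le _ _ _]
      _ ≤ 1 * ((m + 1) * (‖fderiv ℝ χ x‖ * C)) := by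
          gcongr
          exact hC x ⟨hxK, hx⟩
      _ = _ := by ring
  · rw [hψK x hxK, norm_zero, zero_mul]
    positivity

theorem tendsto_integral_cutoff_mul {Ω : Set (Euc (m + 1))} (hΩ : MeasurableSet Ω)
    {χ : ℕ → Euc (m + 1) → ℝ} (hχ : ∀ N, Continuous (χ N)) (hb : ∀ N x, ‖χ N x‖ ≤ 1)
    (hlim : ∀ x ∈ Ω, Tendsto (fun N => χ N x) atTop (𝓝 1)) {f : Euc (m + 1) → ℂ}
    (hf : IntegrableOn f Ω) :
    Tendsto (fun N => ∫ x in Ω, (χ N x : ℂ) * f x) atTop (𝓝 (∫ x in Ω, f x)) := by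
  refine tendsto_integral_of_dominated_convergence (fun x => ‖f x‖)
    (fun N => (integrableOn_cutoff_mul (hχ N) (hb N) hf).aestronglyMeasurable) hf.norm
    (fun N => Eventually.of_forall fun x => ?_) ?_
  · rw [norm_mul, Complex.norm_real]
    exact mul_le_of_le_one_left (norm_nonneg _) (hb N x)
  · filter_upwards [ae_restrict_mem hΩ] with x hx
    simpa using ((Complex.continuous_ofReal.tendsto _).comp (hlim x hx)).mul_const (f x)

end Limits

/-! ### Global Stokes' theorem -/

namespace PiecewiseSmoothBoundary

variable {m : ℕ} {Ω : Set (Euc (m + 1))} (B : PiecewiseSmoothBoundary Ω)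

/-- Local finiteness leaves finitely many patches meeting `K`. Their whole cube boundaries are kept,
so `Z` is closed and its centres stay on the edges. -/
theorem exists_smallCover_edges {K : Set (Euc (m + 1))} (hK : IsCompact K) :
    ∃ Z : Set (Euc (m + 1)), IsClosed Z ∧ SmallCover Z ∧ Z ⊆ B.edges ∧ B.edges ∩ K ⊆ Z := by
  have hfin := B.locallyFinite.finite_nonempty_inter_compact hK
  refine ⟨⋃ i ∈ {i | (B.patch i '' closedCube m ∩ K).Nonempty},
    B.patch i '' (closedCube m \ openCube m), ?_,
    smallCover_biUnion hfin fun i _ => smallCover_image_cube_boundary (B.smooth i), ?_, ?_⟩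
  · exact hfin.isClosed_biUnion fun i _ =>
      (((isCompact_closedCube m).diff (isOpen_openCube m)).image_of_continuousOn
        ((B.smooth i).continuousOn.mono Set.sdiff_subset)).isClosed
  · exact Set.iUnion₂_subset fun i _ => Set.subset_iUnion
      (fun i => B.patch i '' (closedCube m \ openCube m)) i
  · rintro x ⟨hx, hxK⟩
    obtain ⟨i, hi⟩ := Set.mem_iUnion.1 hx
    exact Set.mem_biUnion (⟨x, Set.image_mono Set.sdiff_subset hi, hxK⟩ :
      (B.patch i '' closedCube m ∩ K).Nonempty) hi

/-- Stokes' theorem for a compactly supported form. -/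
theorem stokes_of_hasCompactSupport (hΩ : IsOpen Ω) {η : DiffForm (m + 1) m}
    (hc : ContinuousOn η (closure Ω)) (hd : ContDiffOn ℝ 1 η Ω)
    (hη : IntegrableOn η Ω) (hdη : IntegrableOn (fun x => extDeriv η x (stdFrame (m + 1))) Ω)
    (hbd : B.FormIntegrable η) {ψ : Euc (m + 1) → ℝ} (hψ : ContDiff ℝ 1 ψ)
    (hψc : HasCompactSupport ψ) (hψ1 : ∀ x, ‖ψ x‖ ≤ 1) :
    B.formIntegral (fun y => ψ y • η y) =
      (∫ x in Ω, gradWedge ψ η x) + ∫ x in Ω, (ψ x : ℂ) * extDeriv η x (stdFrame (m + 1)) := by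
  have hd' : ∀ x ∈ Ω, DifferentiableAt ℝ η x := fun x hx =>
    (hd.contDiffAt (hΩ.mem_nhds hx)).differentiableAt (by norm_num)
  obtain ⟨Z, hZc, hZs, hZe, heZ⟩ := B.exists_smallCover_edges (K := tsupport ψ) hψc
  obtain ⟨χ, hχ, hχ1, hχZ, hχlim, hχi, hχ0⟩ := hZs.exists_cutoff hZc
  have hχd : ∀ N x, DifferentiableAt ℝ (χ N) x := fun N => (hχ N).differentiable (by norm_num)
  have hψd : ∀ x, DifferentiableAt ℝ ψ x := hψ.differentiable (by norm_num)
  have hprod : ∀ N, ContDiff ℝ 1 fun y => ψ y * χ N y := fun N => hψ.mul (hχ N)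
  have hprodc : ∀ N, HasCompactSupport fun y => ψ y * χ N y := fun N => hψc.mul_right
  have hprod1 : ∀ N x, ‖ψ x * χ N x‖ ≤ 1 := fun N x => by
    rw [norm_mul]
    exact mul_le_one₀ (hψ1 x) (norm_nonneg _) (hχ1 N x)
  have hΩZ : ∀ x ∈ Ω, x ∉ Z := fun x hx hxZ => by
    have := B.edges_subset_frontier (hZe hxZ)
    rw [hΩ.frontier_eq] at this
    exact this.2 hx
  -- Continuity up to the boundary bounds `η` on the compact set where the edge cutoffs act.
  obtain ⟨C, hC⟩ : ∃ C, ∀ x ∈ tsupport ψ ∩ closure Ω, ‖η x‖ ≤ C :=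
    (IsCompact.inter_right hψc isClosed_closure).exists_bound_of_continuousOn
      (hc.mono Set.inter_subset_right)
  obtain ⟨hψ', ⟨C', hC'⟩, -⟩ := exists_bound_of_hasCompactSupport hψ hψc
  have hgψ : IntegrableOn (gradWedge ψ η) Ω := integrableOn_gradWedge hψ' hC' hη
  have hψdη : IntegrableOn (fun x => (ψ x : ℂ) * extDeriv η x (stdFrame (m + 1))) Ω :=
    integrableOn_cutoff_mul hψ.continuous hψ1 hdη
  have hgprod : ∀ N, IntegrableOn (gradWedge (fun y => ψ y * χ N y) η) Ω := fun N => by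
    obtain ⟨h1, ⟨C₁, hC₁⟩, -⟩ := exists_bound_of_hasCompactSupport (hprod N) (hprodc N)
    exact integrableOn_gradWedge h1 hC₁ hη
  have hstokes : ∀ N, B.formIntegral (fun y => (ψ y * χ N y) • η y) =
      (∫ x in Ω, (ψ x : ℂ) * gradWedge (χ N) η x) +
        ((∫ x in Ω, (χ N x : ℂ) * gradWedge ψ η x) +
          ∫ x in Ω, (χ N x : ℂ) * ((ψ x : ℂ) * extDeriv η x (stdFrame (m + 1)))) := by
    intro N
    have h1 := integrableOn_cutoff_mul (hχ N).continuous (hχ1 N) hgψ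
    have h2 := integrableOn_cutoff_mul (hχ N).continuous (hχ1 N) hψdη
    have h3 : IntegrableOn (fun x => (ψ x : ℂ) * gradWedge (χ N) η x) Ω := by
      refine ((hgprod N).sub h1).congr (Eventually.of_forall fun x => ?_)
      simp only [Pi.sub_apply]
      rw [gradWedge_mul (hχd N x) (hψd x)]
      ring
    have h4 : IntegrableOn (fun x => (χ N x : ℂ) * gradWedge ψ η x +
        (χ N x : ℂ) * ((ψ x : ℂ) * extDeriv η x (stdFrame (m + 1)))) Ω := h1.add h2
    rw [B.stokes_of_disjoint_edges hΩ hc hd hη hdη hbd (hprod N) (hprodc N), ← integral_add h1 h2,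
      ← integral_add h3 h4]
    · refine setIntegral_congr_fun hΩ.measurableSet fun x hx => ?_
      rw [extDeriv_cutoff (hprod N |>.differentiable (by norm_num) x) (hd' x hx),
        gradWedge_mul (hχd N x) (hψd x)]
      push_cast
      ring
    · intro x hx hxe
      exact hχZ N x (heZ ⟨hxe, tsupport_mul_subset_left hx⟩) (tsupport_mul_subset_right hx)
  -- The edges contribute nothing: bounded form against a gradient tending to zero in `L¹`.
  have hl1 : Tendsto (fun N => ∫ x in Ω, (ψ x : ℂ) * gradWedge (χ N) η x) atTop (𝓝 0) := by
    have h1 : Tendsto (fun N => ((m + 1) * max C 0) * ∫ x, ‖fderiv ℝ (χ N) x‖) atTop (𝓝 0) := by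
      simpa using hχ0.const_mul ((m + 1) * max C 0)
    exact squeeze_zero_norm (fun N => norm_integral_cutoff_gradWedge_le hψ1
      (fun x hx => image_eq_zero_of_notMem_tsupport hx) (hχi N) (le_max_right _ _)
      (fun x hx => (hC x ⟨hx.1, subset_closure hx.2⟩).trans (le_max_left _ _)) hΩ.measurableSet) h1
  have hl2 := tendsto_integral_cutoff_mul hΩ.measurableSet (fun N => (hχ N).continuous) hχ1
    (fun x hx => hχlim x (hΩZ x hx)) hgψ
  have hl3 := tendsto_integral_cutoff_mul hΩ.measurableSet (fun N => (hχ N).continuous) hχ1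
    (fun x hx => hχlim x (hΩZ x hx)) hψdη
  have hl := hl1.add (hl2.add hl3)
  rw [zero_add] at hl
  refine tendsto_nhds_unique ?_ hl
  simp only [← hstokes]
  refine B.tendsto_formIntegral_cutoff hbd (fun N => (hprod N).continuous) hprod1 fun i u hu => ?_
  simpa using (hχlim _ fun h => B.patch_notMem_edges i hu (hZe h)).const_mul (ψ (B.patch i u))

/-- **Stokes' theorem** on an open set with piecewise smooth boundary. -/
theorem stokes (hΩ : IsOpen Ω) {η : DiffForm (m + 1) m}
    (hc : ContinuousOn η (closure Ω)) (hd : ContDiffOn ℝ 1 η Ω)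
    (hη : IntegrableOn η Ω) (hdη : IntegrableOn (fun x => extDeriv η x (stdFrame (m + 1))) Ω)
    (hbd : B.FormIntegrable η) :
    B.formIntegral η = ∫ x in Ω, extDeriv η x (stdFrame (m + 1)) := by
  obtain ⟨M, hM0, hM⟩ := exists_norm_fderiv_scaledBump_le m
  set r : ℕ → ℝ := fun N => (N : ℝ) + 1 with hr
  have hr0 : ∀ N, 0 < r N := fun N => by positivity
  have hrlim : Tendsto r atTop atTop := tendsto_atTop_add_const_right _ _ tendsto_natCast_atTop_atTop
  set ψ : ℕ → Euc (m + 1) → ℝ := fun N => scaledBump 0 (r N) with hψ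
  have hψd : ∀ N, ContDiff ℝ 1 (ψ N) := fun N => contDiff_scaledBump 0
  have hψ1 : ∀ N x, ‖ψ N x‖ ≤ 1 := fun N x => by
    rw [Real.norm_eq_abs, abs_of_nonneg (scaledBump_nonneg 0 x)]
    exact scaledBump_le_one 0 x
  have hψlim : ∀ x, Tendsto (fun N => ψ N x) atTop (𝓝 1) := fun x => by
    refine tendsto_const_nhds.congr' ?_
    filter_upwards [hrlim.eventually_ge_atTop (dist x 0)] with N hN
    exact (scaledBump_eq_one 0 (hr0 N) hN).symm
  -- At infinity the roles are exchanged: integrable form against a gradient tending to zero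
  -- uniformly.
  have hl1 : Tendsto (fun N => ∫ x in Ω, gradWedge (ψ N) η x) atTop (𝓝 0) := by
    have h1 : Tendsto (fun N => ((m + 1) * M * ∫ x in Ω, ‖η x‖) * (r N)⁻¹) atTop (𝓝 0) := by
      simpa using (tendsto_inv_atTop_zero.comp hrlim).const_mul ((m + 1) * M * ∫ x in Ω, ‖η x‖)
    refine squeeze_zero_norm (fun N => ?_) h1
    have h2 : ((m + 1) * M * ∫ x in Ω, ‖η x‖) * (r N)⁻¹ =
        ∫ x in Ω, ((m + 1) * (M * (r N)⁻¹)) * ‖η x‖ := by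
      rw [integral_const_mul]
      ring
    rw [h2]
    refine norm_integral_le_of_norm_le (hη.norm.const_mul _) (Eventually.of_forall fun x => ?_)
    refine (norm_gradWedge_le _ _ _).trans ?_
    rw [mul_assoc]
    gcongr
    exact (hM 0 (r N) (hr0 N)).1 x
  have hl2 := tendsto_integral_cutoff_mul hΩ.measurableSet (fun N => (hψd N).continuous) hψ1
    (fun x _ => hψlim x) hdη
  have hl := hl1.add hl2
  rw [zero_add] at hl
  refine tendsto_nhds_unique ?_ hl
  simp only [← B.stokes_of_hasCompactSupport hΩ hc hd hη hdη hbd (hψd _)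
    (hasCompactSupport_scaledBump 0 (hr0 _)) (hψ1 _)]
  have h1 := B.tendsto_formIntegral_cutoff hbd (χ' := fun _ => 1) (fun N => (hψd N).continuous) hψ1
    fun i u _ => hψlim (B.patch i u)
  have h2 : (fun y => (1 : ℝ) • η y) = η := by
    funext y
    exact one_smul ℝ (η y)
  rwa [h2] at h1

end PiecewiseSmoothBoundary

/-! ### From the boundary integral to Fourier inversion -/

section Inversion

open FourierTransform

theorem planeWave_eq_fourierChar {n : ℕ} (k x : Euc n) :
    planeWave k x = (Real.fourierChar (inner ℝ ((2 * Real.pi)⁻¹ • k) x) : ℂ) := by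
  rw [planeWave, Real.fourierChar_apply, real_inner_smul_left]
  congr 1
  have : (Real.pi : ℂ) ≠ 0 := by exact_mod_cast Real.pi_ne_zero
  push_cast
  field_simp

theorem fourier_indicator_eq {n : ℕ} {Ω : Set (Euc n)} (hΩ : MeasurableSet Ω) (q : Euc n → ℂ)
    (k : Euc n) :
    𝓕 (Ω.indicator q) ((2 * Real.pi)⁻¹ • k) = ∫ y in Ω, planeWave (-k) y * q y := by
  rw [Real.fourier_eq, ← integral_indicator hΩ]
  congr 1 with y
  by_cases hy : y ∈ Ω
  · rw [Set.indicator_of_mem hy, Set.indicator_of_mem hy, planeWave_eq_fourierChar, smul_neg,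
      inner_neg_left, real_inner_comm, Circle.smul_def, smul_eq_mul]
  · rw [Set.indicator_of_notMem hy, Set.indicator_of_notMem hy, smul_zero]

theorem integral_eq_integral_comp_two_pi_smul {n : ℕ} (G : Euc n → ℂ) :
    ∫ k, G k = (2 * (Real.pi : ℂ)) ^ n * ∫ w, G ((2 * Real.pi) • w) := by
  have := integral_pow_mul_comp_smul G Real.two_pi_pos
  rw [finrank_euclideanSpace_fin, integral_const_mul] at this
  rw [← this]
  push_cast
  rfl

theorem continuous_planeWave {n : ℕ} : Continuous fun p : Euc n × Euc n => planeWave p.1 p.2 := by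
  unfold planeWave
  fun_prop

theorem norm_planeWave {n : ℕ} (k x : Euc n) : ‖planeWave k x‖ = 1 := by
  rw [planeWave_eq_fourierChar]
  exact Circle.norm_coe _

theorem two_pi_inv_smul_smul {n : ℕ} (w : Euc n) : (2 * Real.pi)⁻¹ • (2 * Real.pi) • w = w :=
  inv_smul_smul₀ Real.two_pi_pos.ne' w

variable {m : ℕ} {Ω : Set (Euc (m + 1))}

theorem spectralIntegrand_eq (B : PiecewiseSmoothBoundary Ω) (L : MvPolynomial (Fin (m + 1)) ℂ)
    (η : Euc (m + 1) → DiffForm (m + 1) m) (x k : Euc (m + 1)) :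
    spectralIntegrand B L η x k = planeWave k x / symbolAt L k * B.formIntegral (η k) := by
  unfold spectralIntegrand PiecewiseSmoothBoundary.formIntegral PiecewiseSmoothBoundary.pullback
  rw [← tsum_mul_left]
  congr 1 with i
  simp only [ContinuousAlternatingMap.smul_apply, smul_eq_mul, integral_const_mul]
  ring

theorem spectralIntegrand_ae_eq (hΩ : MeasurableSet Ω) (B : PiecewiseSmoothBoundary Ω)
    (L : MvPolynomial (Fin (m + 1)) ℂ) (hL : L ≠ 0) (q : Euc (m + 1) → ℂ)
    (η : Euc (m + 1) → DiffForm (m + 1) m)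
    (hS : ∀ k, B.formIntegral (η k) = -(symbolAt L k * ∫ y in Ω, planeWave (-k) y * q y)) :
    ∀ᵐ k, ∀ x, spectralIntegrand B L η x k =
      -(planeWave k x * 𝓕 (Ω.indicator q) ((2 * Real.pi)⁻¹ • k)) := by
  filter_upwards [ae_symbolAt_ne_zero L hL] with k hk x
  rw [spectralIntegrand_eq, hS, fourier_indicator_eq hΩ]
  field_simp

/-- The boundary enters only through `hS`. After that everything is inversion for `Ω.indicator q`,
with `k = 2πw` translating between the two normalisations of the transform. -/
theorem spectral_representation_of_stokes (L : MvPolynomial (Fin (m + 1)) ℂ) (hL : L ≠ 0)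
    (hΩ : IsOpen Ω) (B : PiecewiseSmoothBoundary Ω)
    (q : Euc (m + 1) → ℂ) (hq : ContinuousOn q Ω) (hq_int : IntegrableOn q Ω)
    (η : Euc (m + 1) → DiffForm (m + 1) m)
    (hS : ∀ k, B.formIntegral (η k) = -(symbolAt L k * ∫ y in Ω, planeWave (-k) y * q y)) :
    (∀ x ∈ Ω, ∃ J : ℂ, HasOscillatoryIntegral (fun k => spectralIntegrand B L η x k) J ∧
      q x = -1 / (2 * (Real.pi : ℂ)) ^ (m + 1) * J) ∧
    (∀ φ : Euc (m + 1) → ℂ, ContDiff ℝ ∞ φ → HasCompactSupport φ → tsupport φ ⊆ Ω →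
      Integrable (fun k => ∫ x, φ x * spectralIntegrand B L η x k) ∧
      ∫ x, φ x * q x = -1 / (2 * (Real.pi : ℂ)) ^ (m + 1) *
        ∫ k, ∫ x, φ x * spectralIntegrand B L η x k) ∧
    (∀ x ∈ Ω, Integrable (fun k => spectralIntegrand B L η x k) →
      q x = -1 / (2 * (Real.pi : ℂ)) ^ (m + 1) * ∫ k, spectralIntegrand B L η x k) := by
  have hpi : (2 * (Real.pi : ℂ)) ^ (m + 1) ≠ 0 := by
    have : (Real.pi : ℂ) ≠ 0 := by exact_mod_cast Real.pi_ne_zero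
    exact pow_ne_zero _ (mul_ne_zero two_ne_zero this)
  set f := Ω.indicator q with hf
  have hfi : Integrable f := (integrable_indicator_iff hΩ.measurableSet).2 hq_int
  have hfc : ∀ x ∈ Ω, ContinuousAt f x := fun x hx =>
    (hq.continuousAt (hΩ.mem_nhds hx)).congr
      (by filter_upwards [hΩ.mem_nhds hx] with y hy; rw [hf, Set.indicator_of_mem hy])
  have hfx : ∀ x ∈ Ω, f x = q x := fun x hx => Set.indicator_of_mem hx q
  have hFc : Continuous (𝓕 f) := VectorFourier.fourierIntegral_continuous
    Real.continuous_fourierChar continuous_inner hfi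
  have hFb := norm_fourier_le_integral_norm f
  have hae := spectralIntegrand_ae_eq hΩ.measurableSet B L hL q η hS
  have hpw : ∀ w x : Euc (m + 1), planeWave ((2 * Real.pi) • w) x =
      (Real.fourierChar (inner ℝ w x) : ℂ) := fun w x => by
    rw [planeWave_eq_fourierChar, two_pi_inv_smul_smul]
  refine ⟨fun x hx => ⟨-((2 * (Real.pi : ℂ)) ^ (m + 1) * q x), fun χ hχ => ⟨fun ε hε => ?_, ?_⟩, ?_⟩,
    fun φ hφ hφc hφΩ => ?_, fun x hx hi => ?_⟩
  · have h1 : Integrable fun k => χ (ε • k) *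
        -(planeWave k x * 𝓕 f ((2 * Real.pi)⁻¹ • k)) := by
      refine (χ.integrable.comp_smul hε.ne').mul_bdd (c := ∫ y, ‖f y‖) ?_ ?_
      · exact ((continuous_planeWave.comp (by fun_prop : Continuous fun k : Euc (m + 1) => (k, x))).mul
          (hFc.comp (by fun_prop))).neg.aestronglyMeasurable
      · refine Eventually.of_forall fun k => ?_
        rw [norm_neg, norm_mul, norm_planeWave, one_mul]
        exact hFb _
    refine h1.congr ?_
    filter_upwards [hae] with k hk
    rw [hk]
  -- Under `k = 2πw` the regulator `χ(εk)` becomes `χ((2πε) w)`, so the limit is taken along `2πε`.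
  · have h1 := (tendsto_integral_schwartz_mul_fourier χ hfi (hfc x hx)).comp
      (tendsto_nhdsWithin_iff.2 ⟨(tendsto_nhdsWithin_of_tendsto_nhds (by
        simpa using (continuous_mul_const (2 * Real.pi)).tendsto (0 : ℝ)) :
          Tendsto (fun ε : ℝ => ε * (2 * Real.pi)) (𝓝[>] 0) (𝓝 0)), by
        filter_upwards [self_mem_nhdsWithin] with ε hε
        exact mul_pos hε Real.two_pi_pos⟩)
    have h2 := (h1.const_mul ((2 * (Real.pi : ℂ)) ^ (m + 1))).neg
    rw [hχ, one_mul, hfx x hx] at h2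
    refine h2.congr fun ε => ?_
    rw [integral_congr_ae (g := fun k => χ (ε • k) *
        -(planeWave k x * 𝓕 f ((2 * Real.pi)⁻¹ • k))) (by
      filter_upwards [hae] with k hk
      rw [hk]), integral_eq_integral_comp_two_pi_smul, ← mul_neg, Function.comp_apply,
      ← integral_neg]
    simp only [hpw, two_pi_inv_smul_smul, mul_neg, mul_smul ε]
  · field_simp
  · set φS := hφc.toSchwartzMap hφ with hφS
    set ψ : 𝓢(Euc (m + 1), ℂ) := 𝓕⁻ φS with hψ
    have hφS' : ∀ x, φS x = φ x := fun x => rfl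
    have h1 : (fun k => ∫ x, φ x * spectralIntegrand B L η x k) =ᵐ[volume]
        fun k => -(𝓕 f ((2 * Real.pi)⁻¹ • k) * ψ ((2 * Real.pi)⁻¹ • k)) := by
      filter_upwards [hae] with k hk
      rw [hψ, SchwartzMap.fourierInv_coe, Real.fourierInv_eq, ← integral_const_mul, ← integral_neg]
      congr 1 with x
      rw [hk, planeWave_eq_fourierChar, real_inner_comm, hφS', Circle.smul_def, smul_eq_mul]
      ring
    have h2 : Integrable fun w => -(𝓕 f w * ψ w) :=
      (ψ.integrable.bdd_mul hFc.aestronglyMeasurable (Eventually.of_forall hFb)).neg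
    refine ⟨(h2.comp_smul (inv_ne_zero Real.two_pi_pos.ne')).congr h1.symm, ?_⟩
    rw [integral_congr_ae h1, integral_eq_integral_comp_two_pi_smul fun k =>
      -(𝓕 f ((2 * Real.pi)⁻¹ • k) * ψ ((2 * Real.pi)⁻¹ • k))]
    simp only [two_pi_inv_smul_smul]
    rw [integral_neg, integral_fourier_mul_fourierInv_schwartz φS hfi]
    have h3 : ∫ y, f y * φS y = ∫ x, φ x * q x := by
      congr 1 with y
      by_cases hy : y ∈ Ω
      · rw [hfx y hy, mul_comm, hφS']
      · rw [hφS', image_eq_zero_of_notMem_tsupport (fun h => hy (hφΩ h)), mul_zero, zero_mul]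
    rw [h3]
    field_simp
  · have h1 : (fun k => spectralIntegrand B L η x k) =ᵐ[volume]
        fun k => -(planeWave k x * 𝓕 f ((2 * Real.pi)⁻¹ • k)) := by
      filter_upwards [hae] with k hk
      rw [hk]
    -- Plane waves have modulus one, so integrability of the integrand at a single `x` gives
    -- integrability of the transform.
    have h2 : Integrable (𝓕 f) := by
      have h3 := (((hi.congr h1).comp_smul Real.two_pi_pos.ne')).norm
      simp only [norm_neg, norm_mul, norm_planeWave, one_mul, two_pi_inv_smul_smul] at h3
      exact (integrable_norm_iff hFc.aestronglyMeasurable).1 h3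
    have h3 := hfi.fourierInv_fourier_eq h2 (hfc x hx)
    rw [integral_congr_ae h1, integral_eq_integral_comp_two_pi_smul]
    simp only [two_pi_inv_smul_smul, hpw]
    rw [integral_neg, ← hfx x hx, ← h3, Real.fourierInv_eq]
    simp only [Circle.smul_def, smul_eq_mul]
    field_simp

end Inversion

/-! ### The integral representation -/

theorem mainTheorem3 {m : ℕ} (L : MvPolynomial (Fin (m + 1)) ℂ) (hL : L ≠ 0)
    (Ω : Set (Euc (m + 1))) (hΩ : IsOpen Ω) (B : PiecewiseSmoothBoundary Ω)
    (q : Euc (m + 1) → ℂ) (hq : ContDiffOn ℝ (L.totalDegree : ℕ∞) q Ω)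
    (hq_int : IntegrableOn q Ω) (hLq : ∀ x ∈ Ω, applyPDO L q x = 0)
    (η : Euc (m + 1) → DiffForm (m + 1) m)
    (hη : ∀ k, IsFundamentalForm L Ω q (fun y => planeWave (-k) y) (η k))
    (hη_int : ∀ k, IntegrableOn (η k) Ω) (hη_bdry : ∀ k, B.FormIntegrable (η k)) :
    -- pointwise in `Ω`, the integral over `k` being an oscillatory integral
    (∀ x ∈ Ω, ∃ J : ℂ, HasOscillatoryIntegral (fun k => spectralIntegrand B L η x k) J ∧
      q x = -1 / (2 * (Real.pi : ℂ)) ^ (m + 1) * J) ∧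
    -- in the sense of distributions on `Ω`
    (∀ φ : Euc (m + 1) → ℂ, ContDiff ℝ ∞ φ → HasCompactSupport φ → tsupport φ ⊆ Ω →
      Integrable (fun k => ∫ x, φ x * spectralIntegrand B L η x k) ∧
      ∫ x, φ x * q x = -1 / (2 * (Real.pi : ℂ)) ^ (m + 1) *
        ∫ k, ∫ x, φ x * spectralIntegrand B L η x k) ∧
    -- as a Lebesgue integral at each point of `Ω` where it converges absolutely
    (∀ x ∈ Ω, Integrable (fun k => spectralIntegrand B L η x k) →
      q x = -1 / (2 * (Real.pi : ℂ)) ^ (m + 1) * ∫ k, spectralIntegrand B L η x k) := by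
  refine spectral_representation_of_stokes L hL hΩ B q hq.continuousOn hq_int η fun k => ?_
  -- The plane wave is an eigenfunction of the adjoint, with eigenvalue the symbol of `L` at `k`,
  -- and the term with `L q` drops out.
  have hd : ∀ x ∈ Ω, extDeriv (η k) x (stdFrame (m + 1)) =
      -(symbolAt L k) * (planeWave (-k) x * q x) := by
    intro x hx
    have h1 := (hη k).extDeriv_eq x hx
    have h2 := applyPDO_planeWave (formalAdjoint L) (-k) x
    rw [symbolAt_formalAdjoint_neg] at h2
    rw [hLq x hx, mul_zero, zero_sub] at h1
    refine h1.trans ?_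
    rw [show applyPDO (formalAdjoint L) (fun y => planeWave (-k) y) x = _ from h2]
    ring
  -- Integrability of `dη`, needed for Stokes, follows from that of `q`, since `dη` is a constant
  -- times a unimodular factor times `q`.
  have hi : IntegrableOn (fun x => planeWave (-k) x * q x) Ω :=
    Integrable.bdd_mul (c := 1) hq_int (continuous_planeWave.comp
      (by fun_prop : Continuous fun x : Euc (m + 1) => (-k, x))).aestronglyMeasurable
      (Eventually.of_forall fun x => (norm_planeWave _ _).le)
  rw [B.stokes hΩ (hη k).continuousOn (hη k).contDiffOn (hη_int k)
    ((integrableOn_congr_fun hd hΩ.measurableSet).2 (hi.const_mul _)) (hη_bdry k),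
    setIntegral_congr_fun hΩ.measurableSet hd, integral_const_mul, neg_mul]
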